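/- Let $m\ge n$, $\varepsilon>0$, and let $\mu=\mathcal N(0,\Sigma_\mu)$ on $\mathbb R^m$ and $\nu=\mathcal N(0,\Sigma_\nu)$ on $\mathbb R^n$ be zero-mean Gaussian measures with $\Sigma_\mu=\mathrm{diag}(\lambda_{\mu,1},\dots,\lambda_{\mu,m})$ and $\Sigma_\nu=\mathrm{diag}(\lambda_{\nu,1},\dots,\lambda_{\nu,n})$, whose diagonal entries are positive and listed in non-increasing order, $\lambda_{\mu,1}\ge\dots\ge\lambda_{\mu,m}>0$ and $\lambda_{\nu,1}\ge\dots\ge\lambda_{\nu,n}>0$. Let $\Pi(\mu,\nu)$ be the set of probability measures on $\mathbb R^m\times\mathbb R^n$ with marginals $\mu$ and $\nu$, and define the entropic inner-product Gromov–Wasserstein value $$\mathsf{IGW}_\varepsilon(\mu,\nu)=\min_{\pi\in\Pi(\mu,\nu)}\Big\{\mathbb E\big[(\langle X,X'\rangle-\langle Y,Y'\rangle)^2\big]+\varepsilon\,\mathrm{KL}(\pi\,\|\,\mu\otimes\nu)\Big\},$$ where $(X,Y)$ and $(X',Y')$ are independent with law $\pi$. Write $[x]^+=\max\{x,0\}$.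 Then $$\mathsf{IGW}_\varepsilon(\mu,\nu)=\mathrm{tr}(\Sigma_\mu^2)+\mathrm{tr}(\Sigma_\nu^2)-2\sum_{k=1}^n\Big[\lambda_{\mu,k}\lambda_{\nu,k}-\frac{\varepsilon}{4}\Big]^+ +\frac{\varepsilon}{2}\sum_{k=1}^n\Big[\log(\lambda_{\mu,k}\lambda_{\nu,k})-\log\frac{\varepsilon}{4}\Big]^+ .$$ Moreover, the minimum is attained at the Gaussian coupling $\pi^*=\mathcal N(0,\Sigma_{\pi^*})$, where $$\Sigma_{\pi^*}=\begin{pmatrix}\Sigma_\mu & K^*\\ (K^*)^\top & \Sigma_\nu\end{pmatrix}$$ is positive semidefinite and $K^*\in\mathbb R^{m\times n}$ is the rectangular diagonal matrix with diagonal entries $$K^*_{kk}=\Big(\lambda_{\mu,k}\lambda_{\nu,k}\Big[1-\frac{\varepsilon}{4\lambda_{\mu,k}\lambda_{\nu,k}}\Big]^+\Big)^{1/2},\qquad k=1,\dots,n .$$ -/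

import Mathlib

open MeasureTheory ProbabilityTheory InformationTheory
open scoped ENNReal RealInnerProductSpace

noncomputable section

namespace EntropicIGW

section General

variable {E F : Type*} [NormedAddCommGroup E] [InnerProductSpace ℝ E] [MeasurableSpace E]
  [NormedAddCommGroup F] [InnerProductSpace ℝ F] [MeasurableSpace F]

/-- The set `Π(μ, ν)` of joint laws on `E × F` with marginals `μ` and `ν`. -/
def couplings (μ : Measure E) (ν : Measure F) : Set (Measure (E × F)) :=
  {π | π.map Prod.fst = μ ∧ π.map Prod.snd = ν}

/-- The inner-product Gromov–Wasserstein cost `𝔼 (⟪X, X'⟫ - ⟪Y, Y'⟫)²`, where `(X, Y)` and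
`(X', Y')` are independent with law `π`; it takes values in `[0, ∞]`. -/
def innerCost (π : Measure (E × F)) : ℝ≥0∞ :=
  ∫⁻ z : (E × F) × (E × F), ENNReal.ofReal ((⟪z.1.1, z.2.1⟫ - ⟪z.1.2, z.2.2⟫) ^ 2) ∂(π.prod π)

/-- The objective `𝔼 (⟪X, X'⟫ - ⟪Y, Y'⟫)² + ε KL(π ‖ μ ⊗ ν)`. -/
def objective (ε : ℝ) (μ : Measure E) (ν : Measure F) (π : Measure (E × F)) : ℝ≥0∞ :=
  innerCost π + ENNReal.ofReal ε * klDiv π (μ.prod ν)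

/-- The entropic inner-product Gromov–Wasserstein value `IGW_ε(μ, ν)`. -/
def igw (ε : ℝ) (μ : Measure E) (ν : Measure F) : ℝ≥0∞ :=
  ⨅ π ∈ couplings μ ν, objective ε μ ν π

/-- `π` is an optimal plan: a coupling of `μ` and `ν` that minimizes the objective. -/
def IsOptimalPlan (ε : ℝ) (μ : Measure E) (ν : Measure F) (π : Measure (E × F)) : Prop :=
  π ∈ couplings μ ν ∧ ∀ π' ∈ couplings μ ν, objective ε μ ν π ≤ objective ε μ ν π'

end General

/-- The centred Gaussian measure `N(0, S)` on `ℝ^m × ℝ^n`, where the covariance matrix `S` is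
indexed by the coordinates of `ℝ^m` followed by those of `ℝ^n`. -/
def gaussianProd {m n : ℕ} (S : Matrix (Fin m ⊕ Fin n) (Fin m ⊕ Fin n) ℝ) :
    Measure (EuclideanSpace ℝ (Fin m) × EuclideanSpace ℝ (Fin n)) :=
  (multivariateGaussian 0 S).map EuclideanSpace.sumEquivProd

/-- The `m × n` rectangular diagonal matrix with `k`-th diagonal entry
`(a_k b_k [1 - ε / (4 a_k b_k)]⁺)^{1/2}`. -/
def optCross {m n : ℕ} (ε : ℝ) (a : Fin m → ℝ) (b : Fin n → ℝ) : Matrix (Fin m) (Fin n) ℝ :=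
  Matrix.of fun i j =>
    if (i : ℕ) = (j : ℕ) then √(a i * b j * max (1 - ε / (4 * (a i * b j))) 0) else 0

/-- The block matrix with diagonal blocks `diag(a)`, `diag(b)` and off-diagonal blocks
`K = optCross ε a b` and `Kᵀ`. -/
def optCov {m n : ℕ} (ε : ℝ) (a : Fin m → ℝ) (b : Fin n → ℝ) :
    Matrix (Fin m ⊕ Fin n) (Fin m ⊕ Fin n) ℝ :=
  Matrix.fromBlocks (Matrix.diagonal a) (optCross ε a b) (optCross ε a b).transpose
    (Matrix.diagonal b)

end EntropicIGW

end

/-!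
For a coupling `π` of the two Gaussians, expanding the square gives
`innerCost π = tr(diag(a)²) + tr(diag(b)²) - 2 ∑ K i j ^ 2`, where `K i j = 𝔼 X i Y j` is the
cross-covariance: the transport cost sees only `K`, and the problem is to balance `‖K‖²` against the
relative entropy.

*Lower bound.* Whitening gives the correlation matrix `C i j = K i j / √(a i * b j)`, with singular
values `σ k ∈ [0, 1]` and singular bases `U`, `V`. In these bases `μ ⊗ ν` becomes standard Gaussian
and the coordinate pair number `k` has correlation `σ k`. The Donsker–Varadhan inequality
(`ofReal_integral_le_klDiv`), tested against the log density of independent bivariate Gaussian pairs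
of correlations `t k`, bounds `KL(π ‖ μ ⊗ ν)` below by `∑ klTerm (t k) (σ k)`; for `t = σ` this is
`-½ ∑ log (1 - σ k ^ 2)`. On the other side
`‖K‖² = ∑ a i * b j * C i j ^ 2 ≤ ∑ a k * b k * σ k ^ 2` (`sum_mul_mul_sq_le`): a double
summation by parts reduces this to the bound of the squared mass of an `r × s` corner of `C` by the
`min r s` largest `σ k ^ 2`. The problem now separates into the minimization of
`-2 s d² - (ε / 2) log (1 - d²)` over `d ∈ [0, 1]`, for `s = a k * b k`; the minimum is
`modeValue ε s` (`exists_modeValue_le`).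

*Attainment.* The scalar minimum is reached at `d = optCorr ε s`, so every inequality above is an
equality for the law of `(√a p, √b q)`, where `p` is standard Gaussian and
`q k = t k * p k + √(1 - t k ^ 2) * η k` with `t k = optCorr ε (a k * b k)`. Its covariance is
`optCov ε a b` (`map_rescale_gaussianChannel`), and its density with respect to `μ ⊗ ν` is the
exponential of the test function used in the lower bound (`withDensity_exp_channelLogRatio`), which
gives its relative entropy.
-/

namespace EntropicIGW

open scoped Matrix

/-! ### Weighted sums of squared matrix entries and singular values -/

/-- Summation by parts: if all partial sums of `e` are nonnegative, replacing an antitone weight by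
a constant lower bound only decreases the weighted sum. -/
theorem sum_mul_ge_of_partialSum_nonneg {n : ℕ} (a e : Fin n → ℝ) (ha : Antitone a) (c : ℝ)
    (hc : ∀ i, c ≤ a i) (he : ∀ r : ℕ, 0 ≤ ∑ i : Fin n, if (i : ℕ) < r then e i else 0) :
    c * ∑ i, e i ≤ ∑ i, a i * e i := by
  induction n generalizing c with
  | zero => simp
  | succ n ih =>
    have htot : 0 ≤ ∑ i, e i := by
      simpa [Fin.is_le] using he (n + 1)
    have hprefix : ∀ r : ℕ, 0 ≤ ∑ i : Fin n, if (i : ℕ) < r then e i.castSucc else 0 := by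
      intro r
      have h := he (min r n)
      rw [Fin.sum_univ_castSucc] at h
      simpa using h
    have h := ih (fun i => a i.castSucc) (fun i => e i.castSucc)
      (fun i j hij => ha (Fin.castSucc_le_castSucc_iff.2 hij)) (a (Fin.last n))
      (fun i => ha (Fin.le_last _)) hprefix
    have h2 : c * ∑ i, e i ≤ a (Fin.last n) * ∑ i, e i :=
      mul_le_mul_of_nonneg_right (hc _) htot
    rw [Fin.sum_univ_castSucc (fun i => a i * e i)]
    rw [Fin.sum_univ_castSucc e] at h2 ⊢
    linarith [mul_add (a (Fin.last n)) (∑ i : Fin n, e i.castSucc) (e (Fin.last n))]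

theorem sum_mul_le_sum_mul_of_partialSum_le {n : ℕ} (a p q : Fin n → ℝ) (ha : Antitone a)
    (ha0 : ∀ i, 0 ≤ a i)
    (h : ∀ r : ℕ, (∑ i : Fin n, if (i : ℕ) < r then p i else 0)
      ≤ ∑ i : Fin n, if (i : ℕ) < r then q i else 0) :
    ∑ i, a i * p i ≤ ∑ i, a i * q i := by
  have h1 := sum_mul_ge_of_partialSum_nonneg a (fun i => q i - p i) ha 0 ha0 (fun r => by
    have h2 := sub_nonneg.2 (h r)
    rw [← Finset.sum_sub_distrib] at h2
    refine h2.trans_eq (Finset.sum_congr rfl fun i _ => ?_)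
    split_ifs <;> simp)
  simp only [mul_sub, Finset.sum_sub_distrib, zero_mul] at h1
  linarith

/-- Weights in `[0, 1]` of total mass at most `r` cannot do better on an antitone sequence than
selecting its first `r` terms. -/
theorem sum_mul_weight_le_sum_ite {n : ℕ} (s w : Fin n → ℝ) (hs : Antitone s) (hs0 : ∀ i, 0 ≤ s i)
    (hw0 : ∀ i, 0 ≤ w i) (hw1 : ∀ i, w i ≤ 1) (r : ℕ) (hw : ∑ i, w i ≤ r) :
    ∑ i, s i * w i ≤ ∑ i : Fin n, if (i : ℕ) < r then s i else 0 := by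
  have h := sum_mul_le_sum_mul_of_partialSum_le s w (fun i => if (i : ℕ) < r then 1 else 0)
    hs hs0 ?_
  · simpa using h
  intro q
  rcases le_total q r with hqr | hrq
  · refine Finset.sum_le_sum fun i _ => ?_
    split_ifs with h1 h2
    · exact hw1 i
    · omega
    · rfl
  rcases le_total n r with hnr | hrn
  · refine Finset.sum_le_sum fun i _ => ?_
    have := i.2
    split_ifs with h1 h2
    · exact hw1 i
    · omega
    · rfl
  · calc (∑ i : Fin n, if (i : ℕ) < q then w i else 0) ≤ ∑ i, w i := by
          refine Finset.sum_le_sum fun i _ => ?_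
          split_ifs
          · rfl
          · exact hw0 i
      _ ≤ r := hw
      _ = ∑ i : Fin n, if (i : ℕ) < r then (1 : ℝ) else 0 := by
          rw [Finset.sum_boole, Fin.card_filter_val_lt, min_eq_right hrn]
      _ = _ := by
          refine Finset.sum_congr rfl fun i _ => ?_
          split_ifs <;> first | rfl | omega

theorem sum_sq_sum_mul_orthonormalBasis {n : ℕ}
    (V : OrthonormalBasis (Fin n) ℝ (EuclideanSpace ℝ (Fin n))) (c : Fin n → ℝ) :
    ∑ j, (∑ k, c k * V k j) ^ 2 = ∑ k, c k ^ 2 := by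
  have h := V.repr.symm.norm_map (WithLp.toLp 2 c)
  have h2 : ‖V.repr.symm (WithLp.toLp 2 c)‖ ^ 2 = ‖WithLp.toLp 2 c‖ ^ 2 := by rw [h]
  rw [← V.sum_repr_symm, EuclideanSpace.real_norm_sq_eq, EuclideanSpace.real_norm_sq_eq] at h2
  simpa using h2

theorem sum_sq_apply_orthonormalBasis {n : ℕ}
    (V : OrthonormalBasis (Fin n) ℝ (EuclideanSpace ℝ (Fin n))) (k : Fin n) :
    ∑ j, V k j ^ 2 = 1 := by
  rw [← EuclideanSpace.real_norm_sq_eq, V.norm_eq_one]; norm_num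

theorem sum_sq_orthonormalBasis_apply {n : ℕ}
    (V : OrthonormalBasis (Fin n) ℝ (EuclideanSpace ℝ (Fin n))) (j : Fin n) :
    ∑ k, V k j ^ 2 = 1 := by
  have h := V.sum_sq_norm_inner_right (EuclideanSpace.single j (1 : ℝ))
  simpa [EuclideanSpace.inner_single_right] using h

theorem sum_castLE_le {m n : ℕ} (hmn : n ≤ m) (f : Fin m → ℝ) (hf : ∀ i, 0 ≤ f i) :
    ∑ k : Fin n, f (Fin.castLE hmn k) ≤ ∑ i, f i := by
  have := Finset.sum_map Finset.univ (Fin.castLEEmb hmn) f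
  simp only [Fin.castLEEmb_apply] at this
  rw [← this]
  exact Finset.sum_le_sum_of_subset_of_nonneg (Finset.subset_univ _) fun i _ _ => hf i

theorem sum_eq_sum_castLE {m n : ℕ} (hmn : n ≤ m) (f : Fin m → ℝ)
    (hf : ∀ i : Fin m, n ≤ (i : ℕ) → f i = 0) :
    ∑ i, f i = ∑ k : Fin n, f (Fin.castLE hmn k) := by
  have := Finset.sum_map Finset.univ (Fin.castLEEmb hmn) f
  simp only [Fin.castLEEmb_apply] at this
  rw [← this]
  symm
  refine Finset.sum_subset (Finset.subset_univ _) fun i _ hi => hf i ?_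
  by_contra hlt
  exact hi (Finset.mem_map.2 ⟨⟨i, by omega⟩, Finset.mem_univ _, rfl⟩)

theorem sum_sum_prefix_sq_le {m n : ℕ} (hmn : n ≤ m)
    (U : OrthonormalBasis (Fin m) ℝ (EuclideanSpace ℝ (Fin m))) (r : ℕ) :
    ∑ k : Fin n, ∑ i : Fin m, (if (i : ℕ) < r then U (Fin.castLE hmn k) i ^ 2 else 0) ≤ r := by
  calc _ ≤ ∑ k : Fin m, ∑ i : Fin m, (if (i : ℕ) < r then U k i ^ 2 else 0) :=
        sum_castLE_le hmn (fun k => ∑ i : Fin m, (if (i : ℕ) < r then U k i ^ 2 else 0))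
          fun k => Finset.sum_nonneg fun i _ => by split_ifs <;> positivity
    _ = ∑ i : Fin m, if (i : ℕ) < r then (1 : ℝ) else 0 := by
        rw [Finset.sum_comm]
        refine Finset.sum_congr rfl fun i _ => ?_
        split_ifs
        · exact sum_sq_orthonormalBasis_apply U i
        · simp
    _ ≤ r := by
        rw [Finset.sum_boole, Nat.cast_le, Fin.card_filter_val_lt]
        exact min_le_right _ _

/-- Ky Fan's inequality: the first `r` diagonal entries of `∑ k, s k • U k ⊗ U k` add up to at
most the sum of the `r` largest `s k`. -/
theorem sum_mul_prefix_sq_le {m n : ℕ} (hmn : n ≤ m)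
    (U : OrthonormalBasis (Fin m) ℝ (EuclideanSpace ℝ (Fin m))) (s : Fin n → ℝ) (hs : Antitone s)
    (hs0 : ∀ k, 0 ≤ s k) (r : ℕ) :
    ∑ k : Fin n, s k * ∑ i : Fin m, (if (i : ℕ) < r then U (Fin.castLE hmn k) i ^ 2 else 0)
      ≤ ∑ k : Fin n, if (k : ℕ) < r then s k else 0 := by
  refine sum_mul_weight_le_sum_ite s _ hs hs0
    (fun k => Finset.sum_nonneg fun i _ => by split_ifs <;> positivity) (fun k => ?_) r
    (sum_sum_prefix_sq_le hmn U r)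
  rw [← sum_sq_apply_orthonormalBasis U (Fin.castLE hmn k)]
  refine Finset.sum_le_sum fun i _ => ?_
  split_ifs
  · rfl
  · positivity

/-- The squared mass of the upper left `r × s` corner of a matrix with singular values `σ` is at
most the sum of the `min r s` largest `σ k ^ 2`. -/
theorem sum_corner_sq_le {m n : ℕ} (hmn : n ≤ m)
    (U : OrthonormalBasis (Fin m) ℝ (EuclideanSpace ℝ (Fin m)))
    (V : OrthonormalBasis (Fin n) ℝ (EuclideanSpace ℝ (Fin n)))
    (σ : Fin n → ℝ) (hσ : Antitone σ) (hσ0 : ∀ k, 0 ≤ σ k) (r s : ℕ) :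
    ∑ i : Fin m, ∑ j : Fin n, (if (i : ℕ) < r ∧ (j : ℕ) < s then
        (∑ k, σ k * U (Fin.castLE hmn k) i * V k j) ^ 2 else 0)
      ≤ ∑ k : Fin n, if (k : ℕ) < r ∧ (k : ℕ) < s then σ k ^ 2 else 0 := by
  have hs2 : Antitone fun k => σ k ^ 2 := fun k l hkl => by
    have := hσ hkl
    have := hσ0 l
    dsimp only
    gcongr
  have hrow : ∀ i : Fin m, ∑ j, (∑ k, σ k * U (Fin.castLE hmn k) i * V k j) ^ 2
      = ∑ k, σ k ^ 2 * U (Fin.castLE hmn k) i ^ 2 := fun i => by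
    rw [sum_sq_sum_mul_orthonormalBasis V fun k => σ k * U (Fin.castLE hmn k) i]
    simp [mul_pow]
  have hcol : ∀ j : Fin n, ∑ i, (∑ k, σ k * U (Fin.castLE hmn k) i * V k j) ^ 2
      = ∑ k, σ k ^ 2 * V k j ^ 2 := fun j => by
    -- the coefficients `σ k * V k j` are extended by zero to the whole basis `U`
    set c : Fin m → ℝ := fun l => if h : (l : ℕ) < n then σ ⟨l, h⟩ * V ⟨l, h⟩ j else 0 with hc
    have hc1 : ∀ k : Fin n, c (Fin.castLE hmn k) = σ k * V k j := fun k => by simp [hc]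
    have hc0 : ∀ l : Fin m, n ≤ (l : ℕ) → c l = 0 := fun l hl => by simp [hc, not_lt.2 hl]
    have h := sum_sq_sum_mul_orthonormalBasis U c
    rw [sum_eq_sum_castLE hmn (fun l => c l ^ 2) (fun l hl => by simp [hc0 l hl])] at h
    simp only [hc1, mul_pow] at h
    rw [← h]
    refine Finset.sum_congr rfl fun i _ => ?_
    rw [sum_eq_sum_castLE hmn (fun l => c l * U l i) (fun l hl => by simp [hc0 l hl])]
    congr 1
    refine Finset.sum_congr rfl fun k _ => ?_
    rw [hc1]
    ring
  -- only the smaller of the two restrictions is kept: whole rows or whole columns are summed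
  rcases le_total r s with hrs | hsr
  · calc _ ≤ ∑ i : Fin m, ∑ j : Fin n, (if (i : ℕ) < r then
        (∑ k, σ k * U (Fin.castLE hmn k) i * V k j) ^ 2 else 0) := by
          refine Finset.sum_le_sum fun i _ => Finset.sum_le_sum fun j _ => ?_
          split_ifs <;> first | rfl | omega | positivity
      _ = ∑ k : Fin n, σ k ^ 2 *
          ∑ i : Fin m, (if (i : ℕ) < r then U (Fin.castLE hmn k) i ^ 2 else 0) := by
          simp_rw [Finset.mul_sum]
          rw [Finset.sum_comm]
          rw [Finset.sum_comm]
          conv_rhs => rw [Finset.sum_comm]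
          refine Finset.sum_congr rfl fun i _ => ?_
          split_ifs
          · rw [hrow]
          · simp
      _ ≤ ∑ k : Fin n, if (k : ℕ) < r then σ k ^ 2 else 0 :=
          sum_mul_prefix_sq_le hmn U _ hs2 (fun k => by positivity) r
      _ = _ := by
          refine Finset.sum_congr rfl fun i _ => ?_
          split_ifs <;> first | rfl | omega
  · calc _ ≤ ∑ i : Fin m, ∑ j : Fin n, (if (j : ℕ) < s then
        (∑ k, σ k * U (Fin.castLE hmn k) i * V k j) ^ 2 else 0) := by
          refine Finset.sum_le_sum fun i _ => Finset.sum_le_sum fun j _ => ?_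
          split_ifs <;> first | rfl | omega | positivity
      _ = ∑ k : Fin n, σ k ^ 2 * ∑ j : Fin n, (if (j : ℕ) < s then V k j ^ 2 else 0) := by
          simp_rw [Finset.mul_sum]
          rw [Finset.sum_comm]
          conv_rhs => rw [Finset.sum_comm]
          refine Finset.sum_congr rfl fun j _ => ?_
          split_ifs
          · rw [hcol]
          · simp
      _ ≤ ∑ k : Fin n, if (k : ℕ) < s then σ k ^ 2 else 0 :=
          sum_mul_prefix_sq_le le_rfl V _ hs2 (fun k => by positivity) s
      _ = _ := by
          refine Finset.sum_congr rfl fun i _ => ?_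
          split_ifs <;> first | rfl | omega

/-- Trace inequality `tr(A C B Cᵀ) ≤ ∑ a k * b k * σ k ^ 2` for `A = diag(a)`, `B = diag(b)` with
antitone entries and a matrix `C` with singular values `σ`. -/
theorem sum_mul_mul_sq_le {m n : ℕ} (hmn : n ≤ m) (a : Fin m → ℝ) (b : Fin n → ℝ)
    (ha : Antitone a) (hb : Antitone b) (ha0 : ∀ i, 0 ≤ a i) (hb0 : ∀ j, 0 ≤ b j)
    (U : OrthonormalBasis (Fin m) ℝ (EuclideanSpace ℝ (Fin m)))
    (V : OrthonormalBasis (Fin n) ℝ (EuclideanSpace ℝ (Fin n)))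
    (σ : Fin n → ℝ) (hσ : Antitone σ) (hσ0 : ∀ k, 0 ≤ σ k) :
    ∑ i, ∑ j, a i * b j * (∑ k, σ k * U (Fin.castLE hmn k) i * V k j) ^ 2
      ≤ ∑ k, a (Fin.castLE hmn k) * b k * σ k ^ 2 := by
  set C : Fin m → Fin n → ℝ := fun i j => ∑ k, σ k * U (Fin.castLE hmn k) i * V k j with hC
  -- the prefix in the column index is fixed, and summation by parts is applied to the rows
  have h1 : ∀ s : ℕ, ∑ i, a i * ∑ j : Fin n, (if (j : ℕ) < s then C i j ^ 2 else 0)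
      ≤ ∑ k : Fin n, if (k : ℕ) < s then a (Fin.castLE hmn k) * σ k ^ 2 else 0 := by
    intro s
    have h := sum_mul_le_sum_mul_of_partialSum_le a
      (fun i => ∑ j : Fin n, (if (j : ℕ) < s then C i j ^ 2 else 0))
      (fun i => if h : (i : ℕ) < n then (if (i : ℕ) < s then σ ⟨i, h⟩ ^ 2 else 0) else 0)
      ha ha0 (fun r => by
        rw [sum_eq_sum_castLE hmn
          (fun i : Fin m => if (i : ℕ) < r then
            (if h : (i : ℕ) < n then (if (i : ℕ) < s then σ ⟨i, h⟩ ^ 2 else 0) else 0) else 0)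
          (fun i hi => by simp [not_lt.2 hi])]
        simp only [Fin.val_castLE, Fin.is_lt, dite_true, Fin.eta]
        refine le_trans (le_of_eq ?_) ((sum_corner_sq_le hmn U V σ hσ hσ0 r s).trans_eq ?_)
        · refine Finset.sum_congr rfl fun i _ => ?_
          by_cases hi : (i : ℕ) < r <;> simp [hi, hC]
        · refine Finset.sum_congr rfl fun i _ => ?_
          by_cases hi : (i : ℕ) < r <;> simp [hi])
    rw [sum_eq_sum_castLE hmn (fun i : Fin m => a i *
      (if h : (i : ℕ) < n then (if (i : ℕ) < s then σ ⟨i, h⟩ ^ 2 else 0) else 0))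
      (fun i hi => by simp [not_lt.2 hi])] at h
    refine h.trans_eq (Finset.sum_congr rfl fun k _ => ?_)
    simp only [Fin.val_castLE, Fin.is_lt, dite_true, Fin.eta]
    split_ifs <;> simp
  -- summation by parts over the columns
  have h2 := sum_mul_le_sum_mul_of_partialSum_le b (fun j => ∑ i, a i * C i j ^ 2)
    (fun k => a (Fin.castLE hmn k) * σ k ^ 2) hb hb0 (fun s => by
      refine le_trans (le_of_eq ?_) (h1 s)
      simp_rw [Finset.mul_sum]
      rw [Finset.sum_comm]
      refine Finset.sum_congr rfl fun j _ => ?_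
      split_ifs <;> simp)
  calc _ = ∑ j, b j * ∑ i, a i * C i j ^ 2 := by
        simp_rw [Finset.mul_sum]
        rw [Finset.sum_comm]
        refine Finset.sum_congr rfl fun j _ => Finset.sum_congr rfl fun i _ => ?_
        ring
    _ ≤ _ := h2
    _ = _ := Finset.sum_congr rfl fun k _ => by ring

/-- Singular value decomposition of a linear map. The left singular vectors
`(σ k)⁻¹ • T (V k)` with `σ k ≠ 0` are orthonormal, and are completed to a basis. -/
theorem exists_orthonormalBasis_apply_eq_singularValues_smul {m n : ℕ} (hmn : n ≤ m)
    {E F : Type*} [NormedAddCommGroup E] [InnerProductSpace ℝ E] [FiniteDimensional ℝ E]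
    [NormedAddCommGroup F] [InnerProductSpace ℝ F] [FiniteDimensional ℝ F]
    (hE : Module.finrank ℝ E = n) (hF : Module.finrank ℝ F = m) (T : E →ₗ[ℝ] F) :
    ∃ (U : OrthonormalBasis (Fin m) ℝ F) (V : OrthonormalBasis (Fin n) ℝ E),
      ∀ k : Fin n, T (V k) = T.singularValues k • U (Fin.castLE hmn k) := by
  set V := T.isSymmetric_adjoint_comp_self.eigenvectorBasis hE with hV
  have hinner : ∀ k l, ⟪T (V k), T (V l)⟫ = if k = l then T.singularValues l ^ 2 else 0 := by
    intro k l
    rw [← LinearMap.adjoint_inner_right, ← LinearMap.comp_apply,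
      T.isSymmetric_adjoint_comp_self.apply_eigenvectorBasis hE l, ← T.sq_singularValues_fin hE l,
      inner_smul_right, V.inner_eq_ite]
    split_ifs <;> simp
  set v : Fin m → F := fun i =>
    if h : (i : ℕ) < n then (T.singularValues i)⁻¹ • T (V ⟨i, h⟩) else 0 with hv
  set S : Set (Fin m) := {i | T.singularValues i ≠ 0} with hS
  have hSn : ∀ i ∈ S, (i : ℕ) < n := by
    intro i hi
    by_contra hlt
    exact hi (T.singularValues_of_finrank_le (by omega))
  have horth : Orthonormal ℝ (S.domRestrict v) := by
    rw [orthonormal_iff_ite]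
    rintro ⟨i, hi⟩ ⟨j, hj⟩
    have hi' := hSn i hi
    have hj' := hSn j hj
    simp only [Set.domRestrict_apply, hv, hi', hj', dite_true, inner_smul_left, inner_smul_right,
      hinner, Subtype.mk.injEq, Fin.ext_iff]
    split_ifs with h
    · have : T.singularValues j ≠ 0 := hj
      rw [h]
      simp
      field_simp
    · simp
  obtain ⟨U, hU⟩ := horth.exists_orthonormalBasis_extension_of_card_eq (by simp [hF])
  refine ⟨U, V, fun k => ?_⟩
  by_cases hk : T.singularValues k = 0
  · have := hinner k k
    simp only [if_true, hk] at this
    simp only [hk, zero_smul]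
    simpa using this
  · rw [hU (Fin.castLE hmn k) hk]
    simp [hv, smul_smul, hk]

/-- Singular value decomposition of a matrix, in coordinates; the last clause says
`⟪U k, C (V k)⟫ = σ k`. -/
theorem exists_singularValueDecomposition {m n : ℕ} (hmn : n ≤ m) (C : Matrix (Fin m) (Fin n) ℝ) :
    ∃ (U : OrthonormalBasis (Fin m) ℝ (EuclideanSpace ℝ (Fin m)))
      (V : OrthonormalBasis (Fin n) ℝ (EuclideanSpace ℝ (Fin n))) (σ : Fin n → ℝ),
      Antitone σ ∧ (∀ k, 0 ≤ σ k) ∧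
      (∀ i j, C i j = ∑ k, σ k * U (Fin.castLE hmn k) i * V k j) ∧
      ∀ k, ∑ i, ∑ j, U (Fin.castLE hmn k) i * V k j * C i j = σ k := by
  set T : EuclideanSpace ℝ (Fin n) →ₗ[ℝ] EuclideanSpace ℝ (Fin m) := Matrix.toLpLin 2 2 C with hT
  obtain ⟨U, V, h⟩ := exists_orthonormalBasis_apply_eq_singularValues_smul hmn
    finrank_euclideanSpace_fin finrank_euclideanSpace_fin T
  have happly : ∀ (v : EuclideanSpace ℝ (Fin n)) i, T v i = ∑ j, C i j * v j := fun v i => by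
    simp [hT, Matrix.toLpLin_apply, Matrix.mulVec, dotProduct]
  refine ⟨U, V, fun k => T.singularValues k, fun k l hkl => T.singularValues_antitone hkl,
    fun k => T.singularValues_nonneg k, fun i j => ?_, fun k => ?_⟩
  · have h1 : EuclideanSpace.single j (1 : ℝ) = ∑ k, V k j • V k := by
      conv_lhs => rw [← V.sum_repr' (EuclideanSpace.single j (1 : ℝ))]
      simp [EuclideanSpace.inner_single_right]
    have h2 : C i j = T (EuclideanSpace.single j (1 : ℝ)) i := by
      rw [happly]
      simp
    rw [h2, h1, map_sum]
    simp only [map_smul, h, WithLp.ofLp_sum, Finset.sum_apply, PiLp.smul_apply, smul_eq_mul]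
    exact Finset.sum_congr rfl fun k _ => by ring
  · calc _ = ∑ i, U (Fin.castLE hmn k) i * T (V k) i := by
          refine Finset.sum_congr rfl fun i _ => ?_
          rw [happly, Finset.mul_sum]
          exact Finset.sum_congr rfl fun j _ => by ring
      _ = T.singularValues k * ∑ i, U (Fin.castLE hmn k) i ^ 2 := by
          rw [h, Finset.mul_sum]
          refine Finset.sum_congr rfl fun i _ => ?_
          rw [PiLp.smul_apply, smul_eq_mul]
          ring
      _ = _ := by rw [sum_sq_apply_orthonormalBasis, mul_one]

/-! ### Variational bound for the relative entropy -/

/-- Donsker–Varadhan inequality for a test function with normalized exponential: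
`KL(μ ‖ ν) - ∫ f ∂μ` is the relative entropy of `μ` with respect to the tilted measure
`exp(f) ν`. -/
theorem ofReal_integral_le_klDiv {α : Type*} [MeasurableSpace α] (μ ν : Measure α)
    [IsProbabilityMeasure μ] [IsProbabilityMeasure ν] (f : α → ℝ) (hf : Measurable f)
    (hexp : ∫⁻ x, ENNReal.ofReal (Real.exp (f x)) ∂ν = 1) (hfμ : Integrable f μ) :
    ENNReal.ofReal (∫ x, f x ∂μ) ≤ klDiv μ ν := by
  by_cases hμν : μ ≪ ν
  swap; · simp [hμν]
  by_cases hint : Integrable (llr μ ν) μ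
  swap; · simp [klDiv_of_not_integrable hint]
  have hexpi : Integrable (fun x => Real.exp (f x)) ν := by
    refine (lintegral_ofReal_ne_top_iff_integrable (by fun_prop)
      (ae_of_all _ fun x => (Real.exp_pos _).le)).1 ?_
    simp [hexp]
  have hexp1 : ∫ x, Real.exp (f x) ∂ν = 1 := by
    rw [integral_eq_lintegral_of_nonneg_ae (ae_of_all _ fun x => (Real.exp_pos _).le)
      (by fun_prop), hexp]
    simp
  have h := integral_llr_tilted_right hμν hfμ hexpi hint
  have : IsProbabilityMeasure (ν.tilted f) := isProbabilityMeasure_tilted hexpi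
  have h0 := integral_llr_add_sub_measure_univ_nonneg
    (hμν.trans (absolutelyContinuous_tilted hexpi))
    (integrable_llr_tilted_right hμν hfμ hint hexpi)
  rw [klDiv_of_ac_of_integrable hμν hint]
  refine ENNReal.ofReal_le_ofReal ?_
  simp only [hexp1, Real.log_one, add_zero, probReal_univ] at h h0 ⊢
  linarith

theorem klDiv_withDensity_exp {α : Type*} [MeasurableSpace α] (ν : Measure α)
    [IsProbabilityMeasure ν] (f : α → ℝ) (hf : Measurable f)
    (hexp : ∫⁻ x, ENNReal.ofReal (Real.exp (f x)) ∂ν = 1)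
    (hfi : Integrable f (ν.withDensity fun x => ENNReal.ofReal (Real.exp (f x)))) :
    klDiv (ν.withDensity fun x => ENNReal.ofReal (Real.exp (f x))) ν =
      ENNReal.ofReal (∫ x, f x ∂(ν.withDensity fun x => ENNReal.ofReal (Real.exp (f x)))) := by
  set ρ := ν.withDensity fun x => ENNReal.ofReal (Real.exp (f x)) with hρ
  have : IsProbabilityMeasure ρ := ⟨by rw [hρ, withDensity_apply _ .univ]; simpa using hexp⟩
  have hac : ρ ≪ ν := withDensity_absolutelyContinuous _ _
  have hllr : llr ρ ν =ᵐ[ρ] f := by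
    have h := Measure.rnDeriv_withDensity ν
      (f := fun x => ENNReal.ofReal (Real.exp (f x))) (by fun_prop)
    filter_upwards [hac.ae_le h] with x hx
    simp [llr, hρ, hx, ENNReal.toReal_ofReal (Real.exp_pos _).le]
  rw [klDiv_of_ac_of_integrable hac ((integrable_congr hllr).2 hfi), integral_congr_ae hllr]
  simp

/-! ### Densities of correlated Gaussian pairs -/

/-- The log density, with respect to the standard Gaussian on `ℝ × ℝ`, of the centred Gaussian with
unit variances and correlation `t` (a junk value unless `t ^ 2 < 1`). -/
noncomputable def gaussianLogRatio (t x y : ℝ) : ℝ :=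
  -(1 / 2) * Real.log (1 - t ^ 2) + (2 * t * x * y - t ^ 2 * (x ^ 2 + y ^ 2)) / (2 * (1 - t ^ 2))

/-- Conditionally on the first coordinate `x`, the second coordinate of a standard Gaussian pair of
correlation `t` is `t * x + √(1 - t ^ 2) * η`. -/
theorem withDensity_exp_gaussianLogRatio {t : ℝ} (ht : t ^ 2 < 1) (x : ℝ) :
    (gaussianReal 0 1).withDensity
        (fun y => ENNReal.ofReal (Real.exp (gaussianLogRatio t x y))) =
      (gaussianReal 0 1).map (fun η => t * x + √(1 - t ^ 2) * η) := by
  have hpos : 0 < 1 - t ^ 2 := by linarith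
  obtain ⟨v, hv⟩ : ∃ v : NNReal, (v : ℝ) = 1 - t ^ 2 := ⟨⟨_, hpos.le⟩, rfl⟩
  have hmap : (gaussianReal 0 1).map (fun η => t * x + √(1 - t ^ 2) * η) =
      gaussianReal (t * x) v := by
    rw [show (fun η => t * x + √(1 - t ^ 2) * η) =
      (fun z => t * x + z) ∘ (fun η => √(1 - t ^ 2) * η) from rfl,
      ← Measure.map_map (by fun_prop) (by fun_prop), gaussianReal_map_const_mul,
      gaussianReal_map_const_add]
    congr 1
    · simp
    · ext
      rw [hv, mul_one]
      exact Real.sq_sqrt hpos.le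
  have hne : v ≠ 0 := fun h => hpos.ne' (by rw [← hv, h]; rfl)
  rw [hmap, gaussianReal_of_var_ne_zero _ one_ne_zero, gaussianReal_of_var_ne_zero _ hne,
    ← withDensity_mul _ (by fun_prop) (by unfold gaussianLogRatio; fun_prop)]
  congr 1
  ext y
  simp only [Pi.mul_apply, gaussianPDF]
  rw [← ENNReal.ofReal_mul (gaussianPDFReal_nonneg _ _ _)]
  congr 1
  unfold gaussianPDFReal
  rw [gaussianLogRatio, Real.exp_add,
    show -(1 / 2) * Real.log (1 - t ^ 2) = -(Real.log √(1 - t ^ 2)) by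
      rw [Real.log_sqrt hpos.le]; ring,
    Real.exp_neg, Real.exp_log (Real.sqrt_pos.2 hpos)]
  simp only [NNReal.coe_one, hv, mul_one, sub_zero]
  rw [Real.sqrt_mul (by positivity : (0 : ℝ) ≤ 2 * Real.pi) (1 - t ^ 2), mul_inv, mul_mul_mul_comm,
    ← Real.exp_add]
  congr 2
  field_simp
  ring


theorem pi_withDensity_prod {κ : Type*} [Fintype κ] (μ : κ → Measure ℝ)
    [∀ k, IsProbabilityMeasure (μ k)] (w : κ → ℝ → ℝ≥0∞) (hw : ∀ k, Measurable (w k))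
    [∀ k, SigmaFinite ((μ k).withDensity (w k))] :
    (Measure.pi μ).withDensity (fun y => ∏ k, w k (y k)) =
      Measure.pi fun k => (μ k).withDensity (w k) := by
  symm
  refine Measure.pi_eq fun s hs => ?_
  rw [withDensity_apply _ (MeasurableSet.univ_pi hs), ← lintegral_indicator (.univ_pi hs)]
  have hind : (Set.univ.pi s).indicator (fun y => ∏ k, w k (y k)) =
      fun y => ∏ k, (s k).indicator (w k) (y k) := by
    ext y
    by_cases hy : y ∈ Set.univ.pi s
    · rw [Set.indicator_of_mem hy]
      exact Finset.prod_congr rfl fun k _ => (Set.indicator_of_mem (hy k (Set.mem_univ k)) _).symm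
    · rw [Set.indicator_of_notMem hy]
      simp only [Set.mem_univ_pi, not_forall] at hy
      obtain ⟨k, hk⟩ := hy
      exact (Finset.prod_eq_zero (Finset.mem_univ k) (Set.indicator_of_notMem hk _)).symm
  have hmeas : ∀ k, Measurable ((s k).indicator (w k)) := fun k => (hw k).indicator (hs k)
  simp only [hind]
  rw [lintegral_prod_eq_prod_lintegral_of_indepFun (μ := Measure.pi μ) Finset.univ
    (fun (k : κ) (y : κ → ℝ) => (s k).indicator (w k) (y k))
    (iIndepFun_pi fun k => (hmeas k).aemeasurable)
    (fun k => (hmeas k).comp (measurable_pi_apply k))]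
  refine Finset.prod_congr rfl fun k _ => ?_
  rw [(measurePreserving_eval μ k).lintegral_comp (hmeas k), lintegral_indicator (hs k),
    withDensity_apply _ (hs k)]

/-- The standard Gaussian measure on `ι → ℝ`, as a product measure. -/
noncomputable abbrev stdGaussianPi (ι : Type*) [Fintype ι] : Measure (ι → ℝ) :=
  Measure.pi fun _ : ι => gaussianReal 0 1

/-- The log density, with respect to the standard Gaussian on `(ι → ℝ) × (κ → ℝ)`, of the output
law of `gaussianChannel c t`. -/
noncomputable def channelLogRatio {ι κ : Type*} [Fintype κ] (c : κ → ι) (t : κ → ℝ)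
    (z : (ι → ℝ) × (κ → ℝ)) : ℝ :=
  ∑ k, gaussianLogRatio (t k) (z.1 (c k)) (z.2 k)

/-- The Gaussian channel `(p, η) ↦ (p, t p + √(1 - t²) η)`, with noise `η`; the output
coordinate `k` is fed by the input coordinate `c k`. -/
noncomputable def gaussianChannel {ι κ : Type*} (c : κ → ι) (t : κ → ℝ)
    (z : (ι → ℝ) × (κ → ℝ)) : (ι → ℝ) × (κ → ℝ) :=
  (z.1, fun k => t k * z.1 (c k) + √(1 - t k ^ 2) * z.2 k)

section Channel

variable {ι κ : Type*} [Fintype κ] (c : κ → ι) (t : κ → ℝ)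

theorem measurable_channelLogRatio : Measurable (channelLogRatio c t) := by
  unfold channelLogRatio gaussianLogRatio
  fun_prop

omit [Fintype κ] in
theorem measurable_gaussianChannel : Measurable (gaussianChannel c t) := by
  unfold gaussianChannel
  fun_prop

theorem withDensity_exp_channelLogRatio_snd (ht : ∀ k, t k ^ 2 < 1) (x : ι → ℝ) :
    (stdGaussianPi κ).withDensity
        (fun y => ENNReal.ofReal (Real.exp (channelLogRatio c t (x, y)))) =
      (stdGaussianPi κ).map (fun y => (gaussianChannel c t (x, y)).2) := by
  have hw : ∀ k, Measurable fun y : ℝ =>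
      ENNReal.ofReal (Real.exp (gaussianLogRatio (t k) (x (c k)) y)) := fun k => by
    unfold gaussianLogRatio
    fun_prop
  have heq : (fun y => ENNReal.ofReal (Real.exp (channelLogRatio c t (x, y)))) =
      fun y : κ → ℝ => ∏ k, ENNReal.ofReal (Real.exp (gaussianLogRatio (t k) (x (c k)) (y k))) := by
    ext y
    rw [channelLogRatio, Real.exp_sum, ENNReal.ofReal_prod_of_nonneg fun k _ => (Real.exp_pos _).le]
  have hσ : ∀ k, IsProbabilityMeasure ((gaussianReal 0 1).withDensity fun y =>
      ENNReal.ofReal (Real.exp (gaussianLogRatio (t k) (x (c k)) y))) := fun k => by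
    rw [withDensity_exp_gaussianLogRatio (ht k)]
    exact Measure.isProbabilityMeasure_map (by fun_prop)
  have hσ2 : ∀ k, IsProbabilityMeasure ((gaussianReal 0 1).map
      fun η => t k * x (c k) + √(1 - t k ^ 2) * η) := fun k =>
    Measure.isProbabilityMeasure_map (by fun_prop)
  rw [heq, stdGaussianPi, pi_withDensity_prod _ _ hw]
  simp only [gaussianChannel]
  rw [Measure.pi_map_pi (f := fun k η => t k * x (c k) + √(1 - t k ^ 2) * η)
    (fun k => by fun_prop)]
  congr 1
  ext1 k
  exact withDensity_exp_gaussianLogRatio (ht k) _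

/-- The output law of the Gaussian channel has log density `channelLogRatio` with respect to its
input law. -/
theorem withDensity_exp_channelLogRatio [Fintype ι] (ht : ∀ k, t k ^ 2 < 1) :
    ((stdGaussianPi ι).prod (stdGaussianPi κ)).withDensity
        (fun z => ENNReal.ofReal (Real.exp (channelLogRatio c t z))) =
      ((stdGaussianPi ι).prod (stdGaussianPi κ)).map (gaussianChannel c t) := by
  have hm := measurable_channelLogRatio c t
  have hT := measurable_gaussianChannel c t
  refine Measure.ext_of_lintegral _ fun h hh => ?_
  rw [lintegral_withDensity_eq_lintegral_mul _ (by fun_prop) hh, lintegral_map hh hT,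
    lintegral_prod _ (by fun_prop), lintegral_prod _ (by fun_prop)]
  refine lintegral_congr fun x => ?_
  have hx := withDensity_exp_channelLogRatio_snd c t ht x
  have h1 := lintegral_withDensity_eq_lintegral_mul (stdGaussianPi κ)
    (f := fun y => ENNReal.ofReal (Real.exp (channelLogRatio c t (x, y)))) (by fun_prop)
    (g := fun y => h (x, y)) (by fun_prop)
  rw [hx, lintegral_map (by fun_prop) (by fun_prop)] at h1
  exact h1.symm

/-- The exponential of `channelLogRatio` is a probability density, so that it is admissible in
`ofReal_integral_le_klDiv`. -/
theorem lintegral_exp_channelLogRatio [Fintype ι] (ht : ∀ k, t k ^ 2 < 1) :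
    ∫⁻ z, ENNReal.ofReal (Real.exp (channelLogRatio c t z))
      ∂((stdGaussianPi ι).prod (stdGaussianPi κ)) = 1 := by
  have hT := measurable_gaussianChannel c t
  have h := withDensity_exp_channelLogRatio (ι := ι) c t ht
  have : IsProbabilityMeasure
      (((stdGaussianPi ι).prod (stdGaussianPi κ)).map (gaussianChannel c t)) :=
    Measure.isProbabilityMeasure_map hT.aemeasurable
  rw [← setLIntegral_univ, ← withDensity_apply _ .univ, h, measure_univ]

end Channel

/-- The expectation of `gaussianLogRatio t X Y` for variables with unit second moments and
`𝔼 X Y = d`. -/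
noncomputable def klTerm (t d : ℝ) : ℝ :=
  -(1 / 2) * Real.log (1 - t ^ 2) + t * (d - t) / (1 - t ^ 2)

theorem integral_gaussianLogRatio {Ω : Type*} [MeasurableSpace Ω] (P : Measure Ω)
    [IsProbabilityMeasure P] (X Y : Ω → ℝ) (hX : MemLp X 2 P) (hY : MemLp Y 2 P)
    (hX1 : ∫ z, X z ^ 2 ∂P = 1) (hY1 : ∫ z, Y z ^ 2 ∂P = 1) {t : ℝ} (ht : t ^ 2 < 1) :
    Integrable (fun z => gaussianLogRatio t (X z) (Y z)) P ∧
      ∫ z, gaussianLogRatio t (X z) (Y z) ∂P = klTerm t (∫ z, X z * Y z ∂P) := by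
  have hX2 := hX.integrable_sq
  have hY2 := hY.integrable_sq
  have hXY : Integrable (fun z => X z * Y z) P := hX.integrable_mul hY
  have heq : (fun z => gaussianLogRatio t (X z) (Y z)) = fun z =>
      -(1 / 2) * Real.log (1 - t ^ 2) + ((t / (1 - t ^ 2)) * (X z * Y z) -
        (t ^ 2 / (2 * (1 - t ^ 2))) * (X z ^ 2 + Y z ^ 2)) := by
    ext z
    have : 1 - t ^ 2 ≠ 0 := by linarith
    rw [gaussianLogRatio]
    field_simp
  rw [heq]
  refine ⟨by fun_prop, ?_⟩
  rw [integral_add (by fun_prop) (by fun_prop), integral_sub (by fun_prop) (by fun_prop),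
    integral_const_mul (t / (1 - t ^ 2)), integral_const_mul _ fun z => X z ^ 2 + Y z ^ 2,
    integral_add hX2 hY2, hX1, hY1]
  have : 1 - t ^ 2 ≠ 0 := by linarith
  simp only [integral_const, probReal_univ, one_smul, klTerm]
  field_simp
  ring

theorem integral_channelLogRatio {ι κ : Type*} [Fintype κ] (c : κ → ι) (t : κ → ℝ)
    (ht : ∀ k, t k ^ 2 < 1) (P : Measure ((ι → ℝ) × (κ → ℝ))) [IsProbabilityMeasure P]
    (hX : ∀ i, MemLp (fun z => z.1 i) 2 P) (hY : ∀ k, MemLp (fun z => z.2 k) 2 P)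
    (hX1 : ∀ i, ∫ z, z.1 i ^ 2 ∂P = 1) (hY1 : ∀ k, ∫ z, z.2 k ^ 2 ∂P = 1) :
    Integrable (channelLogRatio c t) P ∧
      ∫ z, channelLogRatio c t z ∂P = ∑ k, klTerm (t k) (∫ z, z.1 (c k) * z.2 k ∂P) := by
  have h := fun k => integral_gaussianLogRatio P _ _ (hX (c k)) (hY k) (hX1 _) (hY1 _) (ht k)
  refine ⟨integrable_finsetSum _ fun k _ => (h k).1, ?_⟩
  unfold channelLogRatio
  rw [integral_finsetSum _ fun k _ => (h k).1]
  exact Finset.sum_congr rfl fun k _ => (h k).2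

/-! ### The inner-product cost in terms of second moments -/

/-- The second moment of `∑ s i * Z i * Z' i`, for an independent copy `Z'` of `Z`, depends only on
the second moments `𝔼 Z i Z j`. -/
theorem integral_sq_sum_mul_prod {Ω ι : Type*} [MeasurableSpace Ω] [Fintype ι] (P : Measure Ω)
    [IsProbabilityMeasure P] (Z : ι → Ω → ℝ) (hZ : ∀ i, MemLp (Z i) 2 P) (s : ι → ℝ) :
    Integrable (fun w : Ω × Ω => (∑ i, s i * (Z i w.1 * Z i w.2)) ^ 2) (P.prod P) ∧
      ∫ w : Ω × Ω, (∑ i, s i * (Z i w.1 * Z i w.2)) ^ 2 ∂(P.prod P) =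
        ∑ i, ∑ j, s i * s j * (∫ x, Z i x * Z j x ∂P) ^ 2 := by
  have hint : ∀ i j, Integrable (fun x => Z i x * Z j x) P := fun i j =>
    (hZ i).integrable_mul (hZ j)
  have hint2 : ∀ i j, Integrable
      (fun w : Ω × Ω => (Z i w.1 * Z j w.1) * (Z i w.2 * Z j w.2)) (P.prod P) :=
    fun i j => (hint i j).mul_prod (hint i j)
  have hexpand : (fun w : Ω × Ω => (∑ i, s i * (Z i w.1 * Z i w.2)) ^ 2) = fun w =>
      ∑ i, ∑ j, s i * s j * ((Z i w.1 * Z j w.1) * (Z i w.2 * Z j w.2)) := by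
    ext w
    rw [sq, Finset.sum_mul_sum]
    exact Finset.sum_congr rfl fun i _ => Finset.sum_congr rfl fun j _ => by ring
  rw [hexpand]
  refine ⟨integrable_finsetSum _ fun i _ => integrable_finsetSum _ fun j _ =>
    (hint2 i j).const_mul _, ?_⟩
  rw [integral_finsetSum _ fun i _ => integrable_finsetSum _ fun j _ => (hint2 i j).const_mul _]
  refine Finset.sum_congr rfl fun i _ => ?_
  rw [integral_finsetSum _ fun j _ => (hint2 i j).const_mul _]
  refine Finset.sum_congr rfl fun j _ => ?_
  rw [integral_const_mul, integral_prod_mul (fun x => Z i x * Z j x) (fun x => Z i x * Z j x), sq]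

theorem innerCost_eq {m n : ℕ} (a : Fin m → ℝ) (b : Fin n → ℝ)
    (π : Measure (EuclideanSpace ℝ (Fin m) × EuclideanSpace ℝ (Fin n))) [IsProbabilityMeasure π]
    (hX : ∀ i, MemLp (fun z => z.1 i) 2 π) (hY : ∀ j, MemLp (fun z => z.2 j) 2 π)
    (hXX : ∀ i i', ∫ z, z.1 i * z.1 i' ∂π = Matrix.diagonal a i i')
    (hYY : ∀ j j', ∫ z, z.2 j * z.2 j' ∂π = Matrix.diagonal b j j') :
    0 ≤ ∑ i, a i ^ 2 + ∑ j, b j ^ 2 - 2 * ∑ i, ∑ j, (∫ z, z.1 i * z.2 j ∂π) ^ 2 ∧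
      innerCost π = ENNReal.ofReal
        (∑ i, a i ^ 2 + ∑ j, b j ^ 2 - 2 * ∑ i, ∑ j, (∫ z, z.1 i * z.2 j ∂π) ^ 2) := by
  obtain ⟨hint, hval⟩ := integral_sq_sum_mul_prod π
    (Sum.elim (fun i z => z.1 i) (fun j z => z.2 j) : Fin m ⊕ Fin n → _ → ℝ)
    (by rintro (i | j); exacts [hX i, hY j]) (Sum.elim (fun _ => 1) (fun _ => -1))
  have hfun : (fun z : (EuclideanSpace ℝ (Fin m) × EuclideanSpace ℝ (Fin n)) ×
      (EuclideanSpace ℝ (Fin m) × EuclideanSpace ℝ (Fin n)) =>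
      (⟪z.1.1, z.2.1⟫ - ⟪z.1.2, z.2.2⟫) ^ 2) = fun w => (∑ p : Fin m ⊕ Fin n,
        (Sum.elim (fun _ => 1) (fun _ => -1) p : ℝ) *
          ((Sum.elim (fun i z => z.1 i) (fun j z => z.2 j) : Fin m ⊕ Fin n →
            EuclideanSpace ℝ (Fin m) × EuclideanSpace ℝ (Fin n) → ℝ) p w.1 *
          (Sum.elim (fun i z => z.1 i) (fun j z => z.2 j) : Fin m ⊕ Fin n →
            EuclideanSpace ℝ (Fin m) × EuclideanSpace ℝ (Fin n) → ℝ) p w.2)) ^ 2 := by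
    ext w
    simp only [PiLp.inner_apply, Fintype.sum_sum_type, Sum.elim_inl, Sum.elim_inr,
      RCLike.inner_apply, conj_trivial, one_mul, neg_mul, Finset.sum_neg_distrib,
      ← sub_eq_add_neg, mul_comm]
  have hYX : ∀ j i, ∫ z, z.2 j * z.1 i ∂π = ∫ z, z.1 i * z.2 j ∂π := fun j i => by
    simp only [mul_comm]
  have hsum : ∀ (k : ℕ) (c : Fin k → ℝ), ∑ i, ∑ j, Matrix.diagonal c i j ^ 2 = ∑ i, c i ^ 2 := by
    intro k c
    refine Finset.sum_congr rfl fun i _ => ?_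
    rw [Finset.sum_eq_single i (fun j _ hj => by simp [Matrix.diagonal_apply_ne' _ hj]) (by simp)]
    simp
  have hval2 : ∫ w, (⟪w.1.1, w.2.1⟫ - ⟪w.1.2, w.2.2⟫) ^ 2 ∂(π.prod π) =
      ∑ i, a i ^ 2 + ∑ j, b j ^ 2 - 2 * ∑ i, ∑ j, (∫ z, z.1 i * z.2 j ∂π) ^ 2 := by
    rw [hfun, hval]
    simp only [Fintype.sum_sum_type, Sum.elim_inl, Sum.elim_inr, one_mul, mul_one, neg_mul,
      hXX, hYY, hYX, Finset.sum_add_distrib, Finset.sum_neg_distrib, hsum, mul_neg]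
    rw [Finset.sum_comm (s := (Finset.univ : Finset (Fin n)))]
    ring
  rw [← hval2]
  refine ⟨integral_nonneg fun w => sq_nonneg _, ?_⟩
  rw [innerCost, ofReal_integral_eq_lintegral_ofReal (by rw [hfun]; exact hint)
    (ae_of_all _ fun w => sq_nonneg _)]

/-! ### The scalar problem for one pair of modes -/

/-- The contribution to the value of a pair of modes with `s = a k * b k`: the minimum over `d` of
`-2 s d² - (ε / 2) log (1 - d²)`. -/
noncomputable def modeValue (ε s : ℝ) : ℝ :=
  -2 * max (s - ε / 4) 0 + ε / 2 * max (Real.log s - Real.log (ε / 4)) 0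

/-- `modeValue ε s` bounds the scalar objective `-2 s d² - (ε / 2) log (1 - d²)` from below;
here `u = 1 - d²`. -/
theorem modeValue_le_of_pos {ε s u : ℝ} (hε : 0 < ε) (hs : 0 < s) (hu : 0 < u) (hu1 : u ≤ 1) :
    modeValue ε s ≤ -2 * s * (1 - u) - ε / 2 * Real.log u := by
  unfold modeValue
  rcases le_total s (ε / 4) with h | h
  · rw [max_eq_right (by linarith), max_eq_right (sub_nonpos.2 (Real.log_le_log hs h))]
    nlinarith [Real.log_le_sub_one_of_pos hu]
  · rw [max_eq_left (by linarith), max_eq_left (sub_nonneg.2 (Real.log_le_log (by linarith) h))]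
    -- equality holds at the minimizer `u = ε / (4 * s)`
    have h1 := Real.log_le_sub_one_of_pos (show 0 < s * u / (ε / 4) by positivity)
    rw [Real.log_div (by positivity) (by positivity), Real.log_mul hs.ne' hu.ne'] at h1
    have h2 : ε / 2 * (s * u / (ε / 4)) = 2 * s * u := by field_simp; ring
    nlinarith

theorem klTerm_self {t : ℝ} : klTerm t t = -(1 / 2) * Real.log (1 - t ^ 2) := by
  simp [klTerm]

/-- For every correlation `d` some test parameter `t` certifies the lower bound `modeValue ε s`.
One takes `t = d` if `d < 1`; for `d = 1` the relative entropy is infinite, and `t` close to `1` is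
enough. -/
theorem exists_modeValue_le {ε s d : ℝ} (hε : 0 < ε) (hs : 0 < s) (hd0 : 0 ≤ d) (hd1 : d ≤ 1) :
    ∃ t : ℝ, t ^ 2 < 1 ∧ modeValue ε s ≤ -2 * s * d ^ 2 + ε * klTerm t d := by
  rcases hd1.lt_or_eq with hd | rfl
  · have hd2 : d ^ 2 < 1 := by nlinarith
    refine ⟨d, hd2, ?_⟩
    rw [klTerm_self]
    have := modeValue_le_of_pos hε hs (u := 1 - d ^ 2) (by linarith) (by nlinarith)
    linarith
  -- `N` is chosen so that `1 - t ^ 2 = exp (-N)` makes `-(1 / 2) * log (1 - t ^ 2)` large enough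
  · set N := max 0 (2 * (modeValue ε s + 2 * s) / ε) with hN
    have hN0 : 0 ≤ N := le_max_left _ _
    have hδ1 : Real.exp (-N) ≤ 1 := Real.exp_le_one_iff.2 (by linarith)
    have hsq : √(1 - Real.exp (-N)) ^ 2 = 1 - Real.exp (-N) := Real.sq_sqrt (by linarith)
    have hlt : √(1 - Real.exp (-N)) ^ 2 < 1 := by rw [hsq]; linarith [Real.exp_pos (-N)]
    refine ⟨√(1 - Real.exp (-N)), hlt, ?_⟩
    have ht0 := Real.sqrt_nonneg (1 - Real.exp (-N))
    have ht1 : √(1 - Real.exp (-N)) ≤ 1 := by nlinarith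
    have h1 : N / 2 ≤ klTerm (√(1 - Real.exp (-N))) 1 := by
      have h2 : 0 ≤ √(1 - Real.exp (-N)) * (1 - √(1 - Real.exp (-N))) / Real.exp (-N) :=
        div_nonneg (mul_nonneg ht0 (by linarith)) (Real.exp_pos _).le
      rw [klTerm, hsq, sub_sub_cancel, Real.log_exp]
      linarith
    have h3 : 2 * (modeValue ε s + 2 * s) ≤ N * ε := (div_le_iff₀ hε).1 (le_max_right _ _)
    nlinarith

/-- The optimal correlation of a pair of modes with `s = a k * b k`. -/
noncomputable def optCorr (ε s : ℝ) : ℝ := √(max (1 - ε / (4 * s)) 0)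

theorem sq_optCorr (ε s : ℝ) : optCorr ε s ^ 2 = max (1 - ε / (4 * s)) 0 :=
  Real.sq_sqrt (le_max_right _ _)

theorem sq_optCorr_lt_one {ε s : ℝ} (hε : 0 < ε) (hs : 0 < s) : optCorr ε s ^ 2 < 1 := by
  rw [sq_optCorr]
  exact max_lt (by linarith [show 0 < ε / (4 * s) by positivity]) one_pos

/-- The minimum `modeValue ε s` is attained at the correlation `optCorr ε s`. -/
theorem modeValue_eq {ε s : ℝ} (hε : 0 < ε) (hs : 0 < s) :
    modeValue ε s = -2 * s * optCorr ε s ^ 2 + ε * klTerm (optCorr ε s) (optCorr ε s) := by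
  rw [klTerm_self, sq_optCorr, modeValue]
  rcases le_total s (ε / 4) with h | h
  · rw [max_eq_right (by linarith), max_eq_right (sub_nonpos.2 (Real.log_le_log hs h)),
      max_eq_right]
    · simp
    · rw [sub_nonpos, le_div_iff₀ (by positivity)]
      linarith
  · rw [max_eq_left (by linarith), max_eq_left (sub_nonneg.2 (Real.log_le_log (by linarith) h)),
      max_eq_left]
    · rw [sub_sub_cancel, show ε / (4 * s) = (ε / 4) / s by field_simp,
        Real.log_div (by positivity) hs.ne']
      field_simp
      ring
    · rw [sub_nonneg, div_le_one (by positivity)]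
      linarith

/-! ### Gaussian couplings and whitened coordinates -/

theorem integral_comp_of_measurePreserving {α β : Type*} [MeasurableSpace α] [MeasurableSpace β]
    {μ : Measure α} {ν : Measure β} {f : α → β} (hf : MeasurePreserving f μ ν) {g : β → ℝ}
    (hg : Measurable g) : ∫ x, g (f x) ∂μ = ∫ y, g y ∂ν := by
  rw [← hf.map_eq, integral_map hf.aemeasurable hg.aestronglyMeasurable]

section Gaussian

variable {ι κ : Type*} [Fintype ι] [DecidableEq ι] [Fintype κ] [DecidableEq κ]

omit [DecidableEq ι] [Fintype κ] [DecidableEq κ] in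
theorem measurable_toLp_mulVec (M : Matrix κ ι ℝ) :
    Measurable fun x : EuclideanSpace ℝ ι => WithLp.toLp 2 (M *ᵥ x.ofLp) := by
  refine (MeasurableEquiv.toLp 2 (κ → ℝ)).measurable.comp (measurable_pi_lambda _ fun k => ?_)
  simp only [Matrix.mulVec, dotProduct]
  fun_prop

/-- A linear image of `N(0, S)` under `M` is `N(0, M S Mᵀ)`. -/
theorem map_mulVec_multivariateGaussian {S : Matrix ι ι ℝ} (hS : S.PosSemidef)
    (M : Matrix κ ι ℝ) :
    (multivariateGaussian 0 S).map (fun x => WithLp.toLp 2 (M *ᵥ x.ofLp)) =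
      multivariateGaussian 0 (M * S * Mᵀ) := by
  have hmeas := measurable_toLp_mulVec M
  have hS' : (M * S * Mᵀ).PosSemidef := by
    simpa [Matrix.conjTranspose_eq_transpose_of_trivial] using hS.mul_mul_conjTranspose_same M
  have : IsProbabilityMeasure
      ((multivariateGaussian 0 S).map (fun x => WithLp.toLp 2 (M *ᵥ x.ofLp))) :=
    Measure.isProbabilityMeasure_map hmeas.aemeasurable
  refine Measure.ext_of_charFun ?_
  ext t
  have h1 : charFun ((multivariateGaussian 0 S).map (fun x => WithLp.toLp 2 (M *ᵥ x.ofLp))) t =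
      charFun (multivariateGaussian 0 S) (WithLp.toLp 2 (Mᵀ *ᵥ t.ofLp)) := by
    rw [charFun_apply, charFun_apply, integral_map hmeas.aemeasurable (by fun_prop)]
    congr 1
    ext x
    congr 3
    simp only [EuclideanSpace.inner_eq_star_dotProduct, star_trivial]
    rw [Matrix.dotProduct_mulVec, ← Matrix.mulVec_transpose]
  rw [h1, charFun_multivariateGaussian hS, charFun_multivariateGaussian hS']
  simp only [inner_zero_right]
  congr 4
  rw [← Matrix.mulVec_mulVec, ← Matrix.mulVec_mulVec, Matrix.dotProduct_mulVec t.ofLp,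
    ← Matrix.mulVec_transpose]

theorem memLp_eval_multivariateGaussian (S : Matrix ι ι ℝ) (i : ι) :
    MemLp (fun x : EuclideanSpace ℝ ι => x i) 2 (multivariateGaussian 0 S) :=
  IsGaussian.memLp_dual (multivariateGaussian 0 S) (EuclideanSpace.proj i) 2 (by simp)

theorem integral_eval_mul_eval_multivariateGaussian {S : Matrix ι ι ℝ} (hS : S.PosSemidef)
    (i j : ι) : ∫ x, x i * x j ∂(multivariateGaussian 0 S) = S i j := by
  have hmean : ∀ i, ∫ x, x i ∂(multivariateGaussian 0 S) = 0 := fun i => by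
    have h := (EuclideanSpace.proj i : EuclideanSpace ℝ ι →L[ℝ] ℝ).integral_comp_comm
      (IsGaussian.integrable_id (μ := multivariateGaussian 0 S))
    simpa using h
  have h := covariance_eval_multivariateGaussian (μ := 0) hS i j
  rw [covariance_eq_sub (memLp_eval_multivariateGaussian S i) (memLp_eval_multivariateGaussian S j),
    hmean, hmean] at h
  simpa using h

theorem map_ofLp_multivariateGaussian_one :
    (multivariateGaussian 0 (1 : Matrix ι ι ℝ)).map WithLp.ofLp = stdGaussianPi ι := by
  rw [multivariateGaussian_zero_one, ← map_pi_eq_stdGaussian,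
    Measure.map_map (by fun_prop) (by fun_prop)]
  exact Measure.map_id

theorem map_toLp_stdGaussianPi :
    (stdGaussianPi ι).map (WithLp.toLp 2) = multivariateGaussian 0 (1 : Matrix ι ι ℝ) := by
  rw [multivariateGaussian_zero_one, map_pi_eq_stdGaussian]

end Gaussian

/-- The whitened coordinates of `x` in the orthonormal basis `U`: the coordinates of
`diag(a)^{-1/2} x`. -/
noncomputable def whiten {m : ℕ} (a : Fin m → ℝ)
    (U : OrthonormalBasis (Fin m) ℝ (EuclideanSpace ℝ (Fin m)))
    (x : EuclideanSpace ℝ (Fin m)) : Fin m → ℝ :=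
  fun i => ∑ j, U i j * (x j / √(a j))

theorem measurable_whiten {m : ℕ} (a : Fin m → ℝ)
    (U : OrthonormalBasis (Fin m) ℝ (EuclideanSpace ℝ (Fin m))) : Measurable (whiten a U) := by
  unfold whiten
  fun_prop

theorem sum_apply_mul_apply {m : ℕ} (U : OrthonormalBasis (Fin m) ℝ (EuclideanSpace ℝ (Fin m)))
    (i i' : Fin m) : ∑ j, U i j * U i' j = if i = i' then 1 else 0 := by
  rw [← U.inner_eq_ite i i']
  simp [PiLp.inner_apply, mul_comm]

theorem map_whiten_multivariateGaussian {m : ℕ} {a : Fin m → ℝ} (ha : ∀ i, 0 < a i)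
    (U : OrthonormalBasis (Fin m) ℝ (EuclideanSpace ℝ (Fin m))) :
    (multivariateGaussian 0 (Matrix.diagonal a)).map (whiten a U) = stdGaussianPi (Fin m) := by
  set M : Matrix (Fin m) (Fin m) ℝ := Matrix.of fun i j => U i j / √(a j) with hM
  have hcov : M * Matrix.diagonal a * Mᵀ = 1 := by
    ext i i'
    rw [Matrix.mul_apply, Matrix.one_apply, ← sum_apply_mul_apply U]
    refine Finset.sum_congr rfl fun j _ => ?_
    have h1 : √(a j) * √(a j) = a j := Real.mul_self_sqrt (ha j).le
    have h2 : √(a j) ≠ 0 := (Real.sqrt_pos.2 (ha j)).ne'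
    simp only [Matrix.mul_diagonal, Matrix.transpose_apply, hM, Matrix.of_apply]
    field_simp
    rw [sq, h1]
  have hfun : whiten a U = WithLp.ofLp ∘ fun x : EuclideanSpace ℝ (Fin m) =>
      WithLp.toLp 2 (M *ᵥ x.ofLp) := by
    ext x i
    simp only [whiten, Function.comp_apply, Matrix.mulVec, dotProduct, hM, Matrix.of_apply]
    exact Finset.sum_congr rfl fun j _ => by ring
  rw [hfun, ← Measure.map_map (by fun_prop) (measurable_toLp_mulVec M),
    map_mulVec_multivariateGaussian (.diagonal fun i => (ha i).le), hcov,
    map_ofLp_multivariateGaussian_one]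

theorem memLp_eval_stdGaussianPi {ι : Type*} [Fintype ι] (i : ι) :
    MemLp (fun x : ι → ℝ => x i) 2 (stdGaussianPi ι) :=
  (memLp_id_gaussianReal (μ := 0) (v := 1) 2).comp_measurePreserving
    (measurePreserving_eval (fun _ : ι => gaussianReal 0 1) i)

theorem integral_sq_eval_stdGaussianPi {ι : Type*} [Fintype ι] (i : ι) :
    ∫ x : ι → ℝ, x i ^ 2 ∂(stdGaussianPi ι) = 1 := by
  classical
  rw [← integral_comp_of_measurePreserving ⟨by fun_prop, map_ofLp_multivariateGaussian_one (ι := ι)⟩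
    (by fun_prop : Measurable fun x : ι → ℝ => x i ^ 2)]
  simpa [sq] using integral_eval_mul_eval_multivariateGaussian (ι := ι) Matrix.PosSemidef.one i i

section Coupling

variable {m n : ℕ} {a : Fin m → ℝ} {b : Fin n → ℝ}
  {π : Measure (EuclideanSpace ℝ (Fin m) × EuclideanSpace ℝ (Fin n))}

theorem isProbabilityMeasure_of_mem_couplings {E F : Type*} [NormedAddCommGroup E]
    [InnerProductSpace ℝ E] [MeasurableSpace E] [NormedAddCommGroup F] [InnerProductSpace ℝ F]
    [MeasurableSpace F] {μ : Measure E} {ν : Measure F} [IsProbabilityMeasure μ]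
    {π : Measure (E × F)} (hπ : π ∈ couplings μ ν) : IsProbabilityMeasure π :=
  ⟨by rw [← Set.preimage_univ (f := Prod.fst), ← Measure.map_apply measurable_fst .univ, hπ.1,
    measure_univ]⟩

variable (hπ : π ∈ couplings (multivariateGaussian 0 (Matrix.diagonal a))
  (multivariateGaussian 0 (Matrix.diagonal b)))

include hπ

theorem measurePreserving_fst_of_mem_couplings :
    MeasurePreserving Prod.fst π (multivariateGaussian 0 (Matrix.diagonal a)) :=
  ⟨measurable_fst, hπ.1⟩

theorem measurePreserving_snd_of_mem_couplings :
    MeasurePreserving Prod.snd π (multivariateGaussian 0 (Matrix.diagonal b)) :=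
  ⟨measurable_snd, hπ.2⟩

theorem memLp_fst (i : Fin m) : MemLp (fun z => z.1 i) 2 π :=
  (memLp_eval_multivariateGaussian _ i).comp_measurePreserving
    (measurePreserving_fst_of_mem_couplings hπ)

theorem memLp_snd (j : Fin n) : MemLp (fun z => z.2 j) 2 π :=
  (memLp_eval_multivariateGaussian _ j).comp_measurePreserving
    (measurePreserving_snd_of_mem_couplings hπ)

theorem integral_fst_mul_fst (ha : ∀ i, 0 < a i) (i i' : Fin m) :
    ∫ z, z.1 i * z.1 i' ∂π = Matrix.diagonal a i i' := by
  rw [← integral_eval_mul_eval_multivariateGaussian (.diagonal fun i => (ha i).le), ← hπ.1,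
    integral_map (by fun_prop) (by fun_prop)]

theorem integral_snd_mul_snd (hb : ∀ j, 0 < b j) (j j' : Fin n) :
    ∫ z, z.2 j * z.2 j' ∂π = Matrix.diagonal b j j' := by
  rw [← integral_eval_mul_eval_multivariateGaussian (.diagonal fun i => (hb i).le), ← hπ.2,
    integral_map (by fun_prop) (by fun_prop)]

theorem innerCost_of_mem_couplings (ha : ∀ i, 0 < a i) (hb : ∀ j, 0 < b j) :
    0 ≤ ∑ i, a i ^ 2 + ∑ j, b j ^ 2 - 2 * ∑ i, ∑ j, (∫ z, z.1 i * z.2 j ∂π) ^ 2 ∧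
      innerCost π = ENNReal.ofReal
        (∑ i, a i ^ 2 + ∑ j, b j ^ 2 - 2 * ∑ i, ∑ j, (∫ z, z.1 i * z.2 j ∂π) ^ 2) := by
  have := isProbabilityMeasure_of_mem_couplings hπ
  exact innerCost_eq a b π (memLp_fst hπ) (memLp_snd hπ) (integral_fst_mul_fst hπ ha)
    (integral_snd_mul_snd hπ hb)

theorem integral_whiten_mul_whiten
    (U : OrthonormalBasis (Fin m) ℝ (EuclideanSpace ℝ (Fin m)))
    (V : OrthonormalBasis (Fin n) ℝ (EuclideanSpace ℝ (Fin n))) (i : Fin m) (k : Fin n) :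
    ∫ z, whiten a U z.1 i * whiten b V z.2 k ∂π =
      ∑ j, ∑ l, U i j * V k l * ((∫ z, z.1 j * z.2 l ∂π) / (√(a j) * √(b l))) := by
  have hint : ∀ j l, Integrable (fun z => z.1 j * z.2 l) π := fun j l =>
    (memLp_fst hπ j).integrable_mul (memLp_snd hπ l)
  have hfun : (fun z : EuclideanSpace ℝ (Fin m) × EuclideanSpace ℝ (Fin n) =>
      whiten a U z.1 i * whiten b V z.2 k) = fun z =>
      ∑ j, ∑ l, U i j * V k l / (√(a j) * √(b l)) * (z.1 j * z.2 l) := by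
    ext z
    rw [whiten, whiten, Finset.sum_mul_sum]
    exact Finset.sum_congr rfl fun j _ => Finset.sum_congr rfl fun l _ => by ring
  rw [hfun, integral_finsetSum _ fun j _ => integrable_finsetSum _ fun l _ =>
    (hint j l).const_mul _]
  refine Finset.sum_congr rfl fun j _ => ?_
  rw [integral_finsetSum _ fun l _ => (hint j l).const_mul _]
  refine Finset.sum_congr rfl fun l _ => ?_
  rw [integral_const_mul]
  ring

theorem integral_channelLogRatio_map_whiten (ha : ∀ i, 0 < a i) (hb : ∀ j, 0 < b j)
    (U : OrthonormalBasis (Fin m) ℝ (EuclideanSpace ℝ (Fin m)))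
    (V : OrthonormalBasis (Fin n) ℝ (EuclideanSpace ℝ (Fin n)))
    (c : Fin n → Fin m) (t : Fin n → ℝ) (ht : ∀ k, t k ^ 2 < 1) :
    Integrable (channelLogRatio c t) (π.map (Prod.map (whiten a U) (whiten b V))) ∧
      ∫ z, channelLogRatio c t z ∂(π.map (Prod.map (whiten a U) (whiten b V))) =
        ∑ k, klTerm (t k) (∫ z, whiten a U z.1 (c k) * whiten b V z.2 k ∂π) := by
  have := isProbabilityMeasure_of_mem_couplings hπ
  have hΦ : Measurable (Prod.map (whiten a U) (whiten b V)) :=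
    (measurable_whiten a U).prodMap (measurable_whiten b V)
  set P := π.map (Prod.map (whiten a U) (whiten b V)) with hP
  have : IsProbabilityMeasure P := Measure.isProbabilityMeasure_map hΦ.aemeasurable
  have h1 : P.map Prod.fst = stdGaussianPi (Fin m) := by
    rw [hP, Measure.map_map measurable_fst hΦ, ← map_whiten_multivariateGaussian ha U, ← hπ.1,
      Measure.map_map (measurable_whiten a U) measurable_fst]
    rfl
  have h2 : P.map Prod.snd = stdGaussianPi (Fin n) := by
    rw [hP, Measure.map_map measurable_snd hΦ, ← map_whiten_multivariateGaussian hb V, ← hπ.2,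
      Measure.map_map (measurable_whiten b V) measurable_snd]
    rfl
  obtain ⟨hi, hv⟩ := integral_channelLogRatio c t ht P
    (fun i => (memLp_eval_stdGaussianPi i).comp_measurePreserving ⟨measurable_fst, h1⟩)
    (fun k => (memLp_eval_stdGaussianPi k).comp_measurePreserving ⟨measurable_snd, h2⟩)
    (fun i => (integral_comp_of_measurePreserving ⟨measurable_fst, h1⟩ (by fun_prop)).trans
      (integral_sq_eval_stdGaussianPi i))
    (fun k => (integral_comp_of_measurePreserving ⟨measurable_snd, h2⟩ (by fun_prop)).trans
      (integral_sq_eval_stdGaussianPi k))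
  refine ⟨hi, hv.trans (Finset.sum_congr rfl fun k _ => ?_)⟩
  rw [hP, integral_map hΦ.aemeasurable (by fun_prop)]
  rfl

omit hπ in
/-- In whitened coordinates the product of the two Gaussians is standard Gaussian. -/
theorem map_whiten_prod (ha : ∀ i, 0 < a i) (hb : ∀ j, 0 < b j)
    (U : OrthonormalBasis (Fin m) ℝ (EuclideanSpace ℝ (Fin m)))
    (V : OrthonormalBasis (Fin n) ℝ (EuclideanSpace ℝ (Fin n))) :
    ((multivariateGaussian 0 (Matrix.diagonal a)).prod
      (multivariateGaussian 0 (Matrix.diagonal b))).map (Prod.map (whiten a U) (whiten b V)) =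
      (stdGaussianPi (Fin m)).prod (stdGaussianPi (Fin n)) := by
  rw [← Measure.map_prod_map _ _ (measurable_whiten a U) (measurable_whiten b V),
    map_whiten_multivariateGaussian ha, map_whiten_multivariateGaussian hb]

/-- Lower bound for the relative entropy of a coupling in terms of its correlations in arbitrary
orthonormal bases. -/
theorem ofReal_sum_klTerm_le_klDiv (ha : ∀ i, 0 < a i) (hb : ∀ j, 0 < b j)
    (U : OrthonormalBasis (Fin m) ℝ (EuclideanSpace ℝ (Fin m)))
    (V : OrthonormalBasis (Fin n) ℝ (EuclideanSpace ℝ (Fin n)))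
    (c : Fin n → Fin m) (t : Fin n → ℝ) (ht : ∀ k, t k ^ 2 < 1) :
    ENNReal.ofReal (∑ k, klTerm (t k) (∫ z, whiten a U z.1 (c k) * whiten b V z.2 k ∂π)) ≤
      klDiv π ((multivariateGaussian 0 (Matrix.diagonal a)).prod
        (multivariateGaussian 0 (Matrix.diagonal b))) := by
  have := isProbabilityMeasure_of_mem_couplings hπ
  have hΦ : Measurable (Prod.map (whiten a U) (whiten b V)) :=
    (measurable_whiten a U).prodMap (measurable_whiten b V)
  have : IsProbabilityMeasure (π.map (Prod.map (whiten a U) (whiten b V))) :=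
    Measure.isProbabilityMeasure_map hΦ.aemeasurable
  obtain ⟨hi, hv⟩ := integral_channelLogRatio_map_whiten hπ ha hb U V c t ht
  -- the data processing inequality reduces the claim to the whitened coordinates
  refine le_trans ?_ (klDiv_map_le _ _ hΦ)
  rw [map_whiten_prod ha hb, ← hv]
  exact ofReal_integral_le_klDiv _ _ _ (measurable_channelLogRatio c t)
    (lintegral_exp_channelLogRatio c t ht) hi

theorem integral_whiten_mul_whiten_le_one (ha : ∀ i, 0 < a i) (hb : ∀ j, 0 < b j)
    (U : OrthonormalBasis (Fin m) ℝ (EuclideanSpace ℝ (Fin m)))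
    (V : OrthonormalBasis (Fin n) ℝ (EuclideanSpace ℝ (Fin n))) (i : Fin m) (k : Fin n) :
    ∫ z, whiten a U z.1 i * whiten b V z.2 k ∂π ≤ 1 := by
  have hU : MeasurePreserving (fun z => whiten a U z.1) π (stdGaussianPi (Fin m)) :=
    MeasurePreserving.comp ⟨measurable_whiten a U, map_whiten_multivariateGaussian ha U⟩
      (measurePreserving_fst_of_mem_couplings hπ)
  have hV : MeasurePreserving (fun z => whiten b V z.2) π (stdGaussianPi (Fin n)) :=
    MeasurePreserving.comp ⟨measurable_whiten b V, map_whiten_multivariateGaussian hb V⟩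
      (measurePreserving_snd_of_mem_couplings hπ)
  have hX : MemLp (fun z => whiten a U z.1 i) 2 π :=
    (memLp_eval_stdGaussianPi i).comp_measurePreserving hU
  have hY : MemLp (fun z => whiten b V z.2 k) 2 π :=
    (memLp_eval_stdGaussianPi k).comp_measurePreserving hV
  have hX1 : ∫ z, whiten a U z.1 i ^ 2 ∂π = 1 :=
    (integral_comp_of_measurePreserving hU (g := fun x => x i ^ 2) (by fun_prop)).trans
      (integral_sq_eval_stdGaussianPi i)
  have hY1 : ∫ z, whiten b V z.2 k ^ 2 ∂π = 1 :=
    (integral_comp_of_measurePreserving hV (g := fun x => x k ^ 2) (by fun_prop)).trans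
      (integral_sq_eval_stdGaussianPi k)
  calc _ ≤ ∫ z, (1 / 2) * (whiten a U z.1 i ^ 2 + whiten b V z.2 k ^ 2) ∂π :=
        integral_mono (hX.integrable_mul hY)
          ((hX.integrable_sq.add hY.integrable_sq).const_mul _)
          fun z => by
            simp only [Pi.mul_apply]
            nlinarith [sq_nonneg (whiten a U z.1 i - whiten b V z.2 k)]
    _ = 1 := by
        rw [integral_const_mul, integral_add hX.integrable_sq hY.integrable_sq, hX1, hY1]
        norm_num

end Coupling

section Optimal

variable {m n : ℕ} {a : Fin m → ℝ} {b : Fin n → ℝ}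

/-! ### The lower bound -/

/-- The value of the problem, as the constant part of the cost plus one term per pair of modes. -/
noncomputable def igwValue (hmn : n ≤ m) (ε : ℝ) (a : Fin m → ℝ) (b : Fin n → ℝ) : ℝ :=
  ∑ i, a i ^ 2 + ∑ j, b j ^ 2 + ∑ k : Fin n, modeValue ε (a (Fin.castLE hmn k) * b k)

theorem ofReal_igwValue_le_objective (hmn : n ≤ m) {ε : ℝ} (hε : 0 < ε) (ha : ∀ i, 0 < a i)
    (hb : ∀ j, 0 < b j) (ha_anti : Antitone a) (hb_anti : Antitone b)
    {π : Measure (EuclideanSpace ℝ (Fin m) × EuclideanSpace ℝ (Fin n))}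
    (hπ : π ∈ couplings (multivariateGaussian 0 (Matrix.diagonal a))
      (multivariateGaussian 0 (Matrix.diagonal b))) :
    ENNReal.ofReal (igwValue hmn ε a b) ≤ objective ε
      (multivariateGaussian 0 (Matrix.diagonal a)) (multivariateGaussian 0 (Matrix.diagonal b))
      π := by
  set K : Fin m → Fin n → ℝ := fun i j => ∫ z, z.1 i * z.2 j ∂π with hK
  obtain ⟨U, V, σ, hσ, hσ0, hC, hσC⟩ := exists_singularValueDecomposition hmn
    (Matrix.of fun i j => K i j / (√(a i) * √(b j)))
  have hcorr : ∀ k, ∫ z, whiten a U z.1 (Fin.castLE hmn k) * whiten b V z.2 k ∂π = σ k := by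
    intro k
    rw [integral_whiten_mul_whiten hπ, ← hσC k]
    rfl
  have hσ1 : ∀ k, σ k ≤ 1 := fun k => by
    rw [← hcorr k]
    exact integral_whiten_mul_whiten_le_one hπ ha hb U V _ _
  have hab : ∀ k, 0 < a (Fin.castLE hmn k) * b k := fun k => mul_pos (ha _) (hb k)
  choose t ht hmode using fun k => exists_modeValue_le hε (hab k) (hσ0 k) (hσ1 k)
  have hKL := ofReal_sum_klTerm_le_klDiv hπ ha hb U V (Fin.castLE hmn) t ht
  simp only [hcorr] at hKL
  have hK2 : ∑ i, ∑ j, K i j ^ 2 ≤ ∑ k, a (Fin.castLE hmn k) * b k * σ k ^ 2 := by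
    refine le_trans (le_of_eq ?_) (sum_mul_mul_sq_le hmn a b ha_anti hb_anti (fun i => (ha i).le)
      (fun j => (hb j).le) U V σ hσ hσ0)
    refine Finset.sum_congr rfl fun i _ => Finset.sum_congr rfl fun j _ => ?_
    rw [← hC i j, Matrix.of_apply, div_pow, mul_pow, Real.sq_sqrt (ha i).le, Real.sq_sqrt (hb j).le,
      mul_div_cancel₀]
    exact (mul_pos (ha i) (hb j)).ne'
  have hle : igwValue hmn ε a b ≤ (∑ i, a i ^ 2 + ∑ j, b j ^ 2 - 2 * ∑ i, ∑ j, K i j ^ 2) +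
      ε * ∑ k, klTerm (t k) (σ k) := by
    have h1 := Finset.sum_le_sum fun k (_ : k ∈ Finset.univ) => hmode k
    simp only [Finset.sum_add_distrib, mul_assoc, ← Finset.mul_sum] at h1
    simp only [mul_assoc] at hK2
    unfold igwValue
    linarith
  calc _ ≤ _ := ENNReal.ofReal_le_ofReal hle
    _ ≤ _ := ENNReal.ofReal_add_le
    _ ≤ _ := by
      rw [objective, (innerCost_of_mem_couplings hπ ha hb).2, ENNReal.ofReal_mul hε.le]
      gcongr

/-! ### The optimal Gaussian coupling -/

/-- A block triangular factor `M` with `M Mᵀ = optCov ε a b`: the matrix of the Gaussian channel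
with the optimal correlations, followed by the rescaling of the coordinates. -/
noncomputable def optFactor (hmn : n ≤ m) (ε : ℝ) (a : Fin m → ℝ) (b : Fin n → ℝ) :
    Matrix (Fin m ⊕ Fin n) (Fin m ⊕ Fin n) ℝ :=
  Matrix.fromBlocks (Matrix.diagonal fun i => √(a i)) 0
    (Matrix.of fun k i => if i = Fin.castLE hmn k then
      √(b k) * optCorr ε (a (Fin.castLE hmn k) * b k) else 0)
    (Matrix.diagonal fun k => √(b k) * √(1 - optCorr ε (a (Fin.castLE hmn k) * b k) ^ 2))

theorem optCross_apply (hmn : n ≤ m) (ε : ℝ) (ha : ∀ i, 0 < a i) (hb : ∀ j, 0 < b j)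
    (i : Fin m) (k : Fin n) :
    optCross ε a b i k = if i = Fin.castLE hmn k then
      √(a (Fin.castLE hmn k)) * √(b k) * optCorr ε (a (Fin.castLE hmn k) * b k) else 0 := by
  have hiff : (i : ℕ) = k ↔ i = Fin.castLE hmn k := by rw [Fin.ext_iff, Fin.val_castLE]
  simp only [optCross, Matrix.of_apply, hiff]
  split_ifs with h
  · rw [h, Real.sqrt_mul (mul_pos (ha _) (hb _)).le, Real.sqrt_mul (ha _).le, optCorr]
  · rfl

theorem optCov_eq (hmn : n ≤ m) {ε : ℝ} (hε : 0 < ε) (ha : ∀ i, 0 < a i) (hb : ∀ j, 0 < b j) :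
    optCov ε a b = optFactor hmn ε a b * (optFactor hmn ε a b)ᵀ := by
  rw [optFactor, Matrix.fromBlocks_transpose, Matrix.fromBlocks_multiply, optCov]
  have h12 : optCross ε a b = (Matrix.diagonal fun i => √(a i)) *
      (Matrix.of fun k i => if i = Fin.castLE hmn k then
        √(b k) * optCorr ε (a (Fin.castLE hmn k) * b k) else 0 : Matrix (Fin n) (Fin m) ℝ)ᵀ := by
    ext i k
    rw [optCross_apply hmn ε ha hb, Matrix.diagonal_mul, Matrix.transpose_apply, Matrix.of_apply]
    split_ifs with h
    · rw [h]; ring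
    · simp
  congr 1
  · ext i i'
    by_cases h : i = i'
    · subst h
      simp [(ha i).le]
    · simp [h]
  · rw [h12]
    simp
  · rw [h12]
    simp [Matrix.transpose_mul]
  · ext k k'
    have hinj : Fin.castLE hmn k = Fin.castLE hmn k' ↔ k = k' := by simp [Fin.ext_iff]
    simp only [Matrix.add_apply, Matrix.mul_apply, Matrix.of_apply, Matrix.transpose_apply,
      Matrix.diagonal_transpose, ite_mul, zero_mul, Finset.sum_ite_eq',
      Finset.mem_univ, if_true, Matrix.diagonal_mul_diagonal, hinj]
    by_cases h : k = k'
    · subst h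
      have h1 : √(b k) * √(b k) = b k := Real.mul_self_sqrt (hb k).le
      have h2 := Real.sq_sqrt (sub_nonneg.2
        (sq_optCorr_lt_one hε (mul_pos (ha (Fin.castLE hmn k)) (hb k))).le)
      simp only [Matrix.diagonal_apply_eq, if_true]
      rw [mul_mul_mul_comm, h1, mul_mul_mul_comm, h1, ← sq, ← sq, h2]
      ring
    · simp [h]

theorem posSemidef_optCov (hmn : n ≤ m) {ε : ℝ} (hε : 0 < ε) (ha : ∀ i, 0 < a i)
    (hb : ∀ j, 0 < b j) : (optCov ε a b).PosSemidef := by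
  rw [optCov_eq hmn hε ha hb, ← Matrix.conjTranspose_eq_transpose_of_trivial]
  exact Matrix.posSemidef_self_mul_conjTranspose _

theorem gaussianProd_optCov_mem_couplings (hmn : n ≤ m) {ε : ℝ} (hε : 0 < ε) (ha : ∀ i, 0 < a i)
    (hb : ∀ j, 0 < b j) :
    gaussianProd (optCov ε a b) ∈ couplings (multivariateGaussian 0 (Matrix.diagonal a))
      (multivariateGaussian 0 (Matrix.diagonal b)) := by
  have hS := posSemidef_optCov hmn hε ha hb
  have hmeas : Measurable (EuclideanSpace.sumEquivProd (𝕜 := ℝ) (ι := Fin m) (κ := Fin n)) :=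
    EuclideanSpace.sumEquivProd.continuous.measurable
  constructor
  · have h := map_mulVec_multivariateGaussian hS (Matrix.fromCols (1 : Matrix (Fin m) (Fin m) ℝ) 0)
    rw [optCov, Matrix.fromCols_mul_fromBlocks, Matrix.transpose_fromCols,
      Matrix.fromCols_mul_fromRows] at h
    simp only [Matrix.one_mul, Matrix.zero_mul, add_zero, Matrix.transpose_one,
      Matrix.transpose_zero, Matrix.mul_one, Matrix.mul_zero] at h
    rw [← h, gaussianProd, Measure.map_map measurable_fst hmeas]
    congr 1
    ext x i
    simp [Matrix.mulVec, dotProduct, Matrix.one_apply]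
  · have h := map_mulVec_multivariateGaussian hS (Matrix.fromCols 0 (1 : Matrix (Fin n) (Fin n) ℝ))
    rw [optCov, Matrix.fromCols_mul_fromBlocks, Matrix.transpose_fromCols,
      Matrix.fromCols_mul_fromRows] at h
    simp only [Matrix.one_mul, Matrix.zero_mul, zero_add, Matrix.transpose_one,
      Matrix.transpose_zero, Matrix.mul_one, Matrix.mul_zero] at h
    rw [← h, gaussianProd, Measure.map_map measurable_snd hmeas]
    congr 1
    ext x i
    simp [Matrix.mulVec, dotProduct, Matrix.one_apply]

theorem integral_fst_mul_snd_gaussianProd {S : Matrix (Fin m ⊕ Fin n) (Fin m ⊕ Fin n) ℝ}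
    (hS : S.PosSemidef) (i : Fin m) (k : Fin n) :
    ∫ z, z.1 i * z.2 k ∂(gaussianProd S) = S (Sum.inl i) (Sum.inr k) := by
  have hmeas : Measurable (EuclideanSpace.sumEquivProd (𝕜 := ℝ) (ι := Fin m) (κ := Fin n)) :=
    EuclideanSpace.sumEquivProd.continuous.measurable
  rw [← integral_eval_mul_eval_multivariateGaussian hS, gaussianProd,
    integral_map hmeas.aemeasurable (by fun_prop)]
  rfl

theorem integral_fst_mul_snd_gaussianProd_optCov (hmn : n ≤ m) {ε : ℝ} (hε : 0 < ε)
    (ha : ∀ i, 0 < a i) (hb : ∀ j, 0 < b j) (i : Fin m) (k : Fin n) :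
    ∫ z, z.1 i * z.2 k ∂(gaussianProd (optCov ε a b)) = if i = Fin.castLE hmn k then
      √(a (Fin.castLE hmn k)) * √(b k) * optCorr ε (a (Fin.castLE hmn k) * b k) else 0 := by
  rw [integral_fst_mul_snd_gaussianProd (posSemidef_optCov hmn hε ha hb), optCov,
    Matrix.fromBlocks_apply₁₂, optCross_apply hmn ε ha hb]

/-- The inverse of whitening in the standard bases. -/
noncomputable def rescale (a : Fin m → ℝ) (b : Fin n → ℝ) (z : (Fin m → ℝ) × (Fin n → ℝ)) :
    EuclideanSpace ℝ (Fin m) × EuclideanSpace ℝ (Fin n) :=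
  (WithLp.toLp 2 fun i => √(a i) * z.1 i, WithLp.toLp 2 fun k => √(b k) * z.2 k)

theorem measurable_rescale : Measurable (rescale a b) := by
  unfold rescale
  fun_prop

theorem whiten_rescale (ha : ∀ i, 0 < a i) (hb : ∀ j, 0 < b j) :
    Prod.map (whiten a (EuclideanSpace.basisFun (Fin m) ℝ))
      (whiten b (EuclideanSpace.basisFun (Fin n) ℝ)) ∘ rescale a b = id := by
  have h1 : ∀ i, √(a i) ≠ 0 := fun i => (Real.sqrt_pos.2 (ha i)).ne'
  have h2 : ∀ i, √(b i) ≠ 0 := fun i => (Real.sqrt_pos.2 (hb i)).ne'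
  ext z i
  · simp [whiten, rescale, h1]
  · simp [whiten, rescale, h2]

theorem rescale_whiten (ha : ∀ i, 0 < a i) (hb : ∀ j, 0 < b j) :
    rescale a b ∘ Prod.map (whiten a (EuclideanSpace.basisFun (Fin m) ℝ))
      (whiten b (EuclideanSpace.basisFun (Fin n) ℝ)) = id := by
  have h1 : ∀ i, √(a i) ≠ 0 := fun i => (Real.sqrt_pos.2 (ha i)).ne'
  have h2 : ∀ i, √(b i) ≠ 0 := fun i => (Real.sqrt_pos.2 (hb i)).ne'
  ext z i
  · simp [whiten, rescale, h1, mul_div_cancel₀]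
  · simp [whiten, rescale, h2, mul_div_cancel₀]

/-- The Gaussian coupling with covariance `optCov ε a b` is the rescaled output law of the Gaussian
channel with correlations `optCorr ε (a k * b k)`. -/
theorem map_rescale_gaussianChannel (hmn : n ≤ m) {ε : ℝ} (hε : 0 < ε) (ha : ∀ i, 0 < a i)
    (hb : ∀ j, 0 < b j) :
    (((stdGaussianPi (Fin m)).prod (stdGaussianPi (Fin n))).map
      (gaussianChannel (Fin.castLE hmn) fun k => optCorr ε (a (Fin.castLE hmn k) * b k))).map
        (rescale a b) = gaussianProd (optCov ε a b) := by
  have hmeas : Measurable (EuclideanSpace.sumEquivProd (𝕜 := ℝ) (ι := Fin m) (κ := Fin n)) :=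
    EuclideanSpace.sumEquivProd.continuous.measurable
  have hprod := (measurePreserving_sumPiEquivProdPi
    (fun _ : Fin m ⊕ Fin n => gaussianReal 0 1)).map_eq
  have hT := measurable_gaussianChannel (Fin.castLE hmn)
    fun k => optCorr ε (a (Fin.castLE hmn k) * b k)
  have hcov : optCov ε a b = optFactor hmn ε a b * 1 * (optFactor hmn ε a b)ᵀ := by
    rw [mul_one, optCov_eq hmn hε ha hb]
  rw [gaussianProd, hcov, ← map_mulVec_multivariateGaussian .one,
    ← map_toLp_stdGaussianPi, ← hprod,
    Measure.map_map hT (MeasurableEquiv.measurable _),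
    Measure.map_map measurable_rescale (hT.comp (MeasurableEquiv.measurable _)),
    Measure.map_map (measurable_toLp_mulVec _) (by fun_prop),
    Measure.map_map hmeas ((measurable_toLp_mulVec _).comp (by fun_prop))]
  congr 1
  ext x i
  · simp [rescale, gaussianChannel, optFactor, Matrix.mulVec, dotProduct, Matrix.diagonal_apply,
      MeasurableEquiv.sumPiEquivProdPi, Equiv.sumPiEquivProdPi]
  · simp [rescale, gaussianChannel, optFactor, Matrix.mulVec, dotProduct, Matrix.diagonal_apply,
      MeasurableEquiv.sumPiEquivProdPi, Equiv.sumPiEquivProdPi]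
    ring

/-- Upper bound for the relative entropy of the Gaussian coupling. Since `rescale` is
invertible this is an equality, but only the data processing inequality is needed. -/
theorem klDiv_gaussianProd_optCov_le (hmn : n ≤ m) {ε : ℝ} (hε : 0 < ε) (ha : ∀ i, 0 < a i)
    (hb : ∀ j, 0 < b j) :
    klDiv (gaussianProd (optCov ε a b)) ((multivariateGaussian 0 (Matrix.diagonal a)).prod
        (multivariateGaussian 0 (Matrix.diagonal b))) ≤
      ENNReal.ofReal (∑ k : Fin n, klTerm (optCorr ε (a (Fin.castLE hmn k) * b k))
        (optCorr ε (a (Fin.castLE hmn k) * b k))) := by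
  set t : Fin n → ℝ := fun k => optCorr ε (a (Fin.castLE hmn k) * b k) with ht
  set γ := (stdGaussianPi (Fin m)).prod (stdGaussianPi (Fin n)) with hγ
  have ht1 : ∀ k, t k ^ 2 < 1 := fun k => sq_optCorr_lt_one hε (mul_pos (ha _) (hb k))
  have hT := measurable_gaussianChannel (Fin.castLE hmn) t
  set P := γ.map (gaussianChannel (Fin.castLE hmn) t) with hP
  have : IsProbabilityMeasure P := Measure.isProbabilityMeasure_map hT.aemeasurable
  have hPπ : P.map (rescale a b) = gaussianProd (optCov ε a b) :=
    map_rescale_gaussianChannel hmn hε ha hb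
  set I := EuclideanSpace.basisFun (Fin m) ℝ with hI
  set J := EuclideanSpace.basisFun (Fin n) ℝ with hJ
  have hΦ : Measurable (Prod.map (whiten a I) (whiten b J)) :=
    (measurable_whiten a I).prodMap (measurable_whiten b J)
  have hγμ : γ.map (rescale a b) = (multivariateGaussian 0 (Matrix.diagonal a)).prod
      (multivariateGaussian 0 (Matrix.diagonal b)) := by
    rw [hγ, ← map_whiten_prod ha hb I J, Measure.map_map measurable_rescale hΦ,
      rescale_whiten ha hb, Measure.map_id]
  have hπP : (gaussianProd (optCov ε a b)).map (Prod.map (whiten a I) (whiten b J)) = P := by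
    rw [← hPπ, Measure.map_map hΦ measurable_rescale, whiten_rescale ha hb, Measure.map_id]
  have hmem := gaussianProd_optCov_mem_couplings hmn hε ha hb
  obtain ⟨hi, hv⟩ := integral_channelLogRatio_map_whiten hmem ha hb I J (Fin.castLE hmn) t ht1
  rw [hπP] at hi hv
  have hcorr : ∀ k, ∫ z, whiten a I z.1 (Fin.castLE hmn k) * whiten b J z.2 k
      ∂(gaussianProd (optCov ε a b)) = t k := fun k => by
    rw [integral_whiten_mul_whiten hmem]
    simp only [integral_fst_mul_snd_gaussianProd_optCov hmn hε ha hb]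
    rw [Finset.sum_eq_single (Fin.castLE hmn k) (fun i _ hi => by simp [hI, hi]) (by simp),
      Finset.sum_eq_single k (fun j _ hj => by simp [hJ, hj]) (by simp)]
    have h1 : √(a (Fin.castLE hmn k)) ≠ 0 := (Real.sqrt_pos.2 (ha _)).ne'
    have h2 : √(b k) ≠ 0 := (Real.sqrt_pos.2 (hb _)).ne'
    simp [hI, hJ, ht]
    field_simp
  simp only [hcorr] at hv
  have hdens := withDensity_exp_channelLogRatio (ι := Fin m) (Fin.castLE hmn) t ht1
  rw [← hPπ, ← hγμ]
  refine (klDiv_map_le P γ measurable_rescale).trans ?_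
  have hkl := klDiv_withDensity_exp γ (channelLogRatio (Fin.castLE hmn) t)
    (measurable_channelLogRatio _ t) (lintegral_exp_channelLogRatio _ t ht1)
  rw [hdens] at hkl
  rw [hkl hi, hv]

theorem objective_gaussianProd_optCov_le (hmn : n ≤ m) {ε : ℝ} (hε : 0 < ε) (ha : ∀ i, 0 < a i)
    (hb : ∀ j, 0 < b j) :
    0 ≤ igwValue hmn ε a b ∧ objective ε (multivariateGaussian 0 (Matrix.diagonal a))
      (multivariateGaussian 0 (Matrix.diagonal b)) (gaussianProd (optCov ε a b)) ≤
        ENNReal.ofReal (igwValue hmn ε a b) := by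
  set t : Fin n → ℝ := fun k => optCorr ε (a (Fin.castLE hmn k) * b k) with ht
  have ht1 : ∀ k, t k ^ 2 < 1 := fun k => sq_optCorr_lt_one hε (mul_pos (ha _) (hb k))
  obtain ⟨h0, hcost⟩ :=
    innerCost_of_mem_couplings (gaussianProd_optCov_mem_couplings hmn hε ha hb) ha hb
  have hK : ∑ i, ∑ j, (∫ z, z.1 i * z.2 j ∂(gaussianProd (optCov ε a b))) ^ 2 =
      ∑ k, a (Fin.castLE hmn k) * b k * t k ^ 2 := by
    rw [Finset.sum_comm]
    refine Finset.sum_congr rfl fun k _ => ?_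
    simp only [integral_fst_mul_snd_gaussianProd_optCov hmn hε ha hb]
    simp [mul_pow, Real.sq_sqrt (ha _).le, Real.sq_sqrt (hb _).le, ht]
  rw [hK] at h0 hcost
  have hkl0 : 0 ≤ ∑ k, klTerm (t k) (t k) := Finset.sum_nonneg fun k _ => by
    rw [klTerm_self]
    have := Real.log_nonpos (by linarith [ht1 k]) (by linarith [sq_nonneg (t k)] : 1 - t k ^ 2 ≤ 1)
    linarith
  have hval : igwValue hmn ε a b = (∑ i, a i ^ 2 + ∑ j, b j ^ 2 -
      2 * ∑ k, a (Fin.castLE hmn k) * b k * t k ^ 2) + ε * ∑ k, klTerm (t k) (t k) := by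
    unfold igwValue
    rw [Finset.sum_congr rfl fun k _ => modeValue_eq hε (mul_pos (ha (Fin.castLE hmn k)) (hb k)),
      Finset.sum_add_distrib, ← Finset.mul_sum]
    simp only [mul_assoc, ← Finset.mul_sum, ht]
    ring
  rw [hval]
  refine ⟨by positivity, ?_⟩
  rw [ENNReal.ofReal_add h0 (by positivity), ENNReal.ofReal_mul hε.le, objective, hcost]
  gcongr
  exact klDiv_gaussianProd_optCov_le hmn hε ha hb

end Optimal

end EntropicIGW

theorem theorem1 {m n : ℕ} (hmn : n ≤ m) (ε : ℝ) (hε : 0 < ε)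
    (a : Fin m → ℝ) (b : Fin n → ℝ) (ha : ∀ i, 0 < a i) (hb : ∀ j, 0 < b j)
    (ha_anti : Antitone a) (hb_anti : Antitone b)
    (μ : Measure (EuclideanSpace ℝ (Fin m))) (ν : Measure (EuclideanSpace ℝ (Fin n)))
    (hμ : μ = multivariateGaussian 0 (Matrix.diagonal a))
    (hν : ν = multivariateGaussian 0 (Matrix.diagonal b)) :
    (EntropicIGW.igw ε μ ν ≠ ∞ ∧
      (EntropicIGW.igw ε μ ν).toReal =
        (Matrix.diagonal a ^ 2).trace + (Matrix.diagonal b ^ 2).trace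
          - 2 * ∑ k : Fin n, max (a (Fin.castLE hmn k) * b k - ε / 4) 0
          + ε / 2 * ∑ k : Fin n,
              max (Real.log (a (Fin.castLE hmn k) * b k) - Real.log (ε / 4)) 0) ∧
    (EntropicIGW.optCov ε a b).PosSemidef ∧
    EntropicIGW.IsOptimalPlan ε μ ν (EntropicIGW.gaussianProd (EntropicIGW.optCov ε a b)) := by
  subst hμ hν
  have hmem := EntropicIGW.gaussianProd_optCov_mem_couplings hmn hε ha hb
  obtain ⟨h0, hub⟩ := EntropicIGW.objective_gaussianProd_optCov_le hmn hε ha hb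
  have hlb := fun π hπ => EntropicIGW.ofReal_igwValue_le_objective (π := π) hmn hε ha hb
    ha_anti hb_anti hπ
  have hval : EntropicIGW.igw ε (multivariateGaussian 0 (Matrix.diagonal a))
      (multivariateGaussian 0 (Matrix.diagonal b)) =
        ENNReal.ofReal (EntropicIGW.igwValue hmn ε a b) :=
    le_antisymm ((iInf₂_le _ hmem).trans hub) (le_iInf₂ hlb)
  refine ⟨⟨hval ▸ ENNReal.ofReal_ne_top, ?_⟩, EntropicIGW.posSemidef_optCov hmn hε ha hb, hmem,
    fun π hπ => hub.trans (hlb π hπ)⟩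
  rw [hval, ENNReal.toReal_ofReal h0]
  simp only [EntropicIGW.igwValue, EntropicIGW.modeValue, Finset.sum_add_distrib, ← Finset.mul_sum,
    Matrix.diagonal_pow, Matrix.trace_diagonal, Pi.pow_apply]
  ring
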